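/- Let $\mathfrak g$ be a real Lie algebra. Write $d\colon\mathfrak g^*\to\bigwedge^2\mathfrak g^*$ for the linear map dual to the bracket, $d\sigma(X,Y)=-\sigma([X,Y])$, put $V_1=\ker d$, and let $b_1=\dim V_1$ (the first Betti number of $\mathfrak g$). A complex structure on $\mathfrak g$ is a linear map $J\colon\mathfrak g\to\mathfrak g$ with $J^2=-1$ and $[JX,JY]=[X,Y]+J[JX,Y]+J[X,JY]$ for all $X,Y\in\mathfrak g$; it acts on $\mathfrak g^*$ by transposition. A tuple $(0,0,0,0,de^5,de^6)$, in which $ij$ abbreviates $e^i\wedge e^j$, denotes the 6-dimensional real Lie algebra whose dual has a basis $e^1,\dots,e^6$ satisfying $de^1=de^2=de^3=de^4=0$ and with $de^5,de^6$ as given. **Theorem 3.3.** A 6-dimensional real nilpotent Lie algebra with $b_1=4$ that admits a complex structure is isomorphic to one of $$(0,0,0,0,12,14+25),\quad(0,0,0,0,12,13),\quad(0,0,0,0,13+42,14+23),\quad(0,0,0,0,12,14+23),\quad(0,0,0,0,12,34).$$ If $J$ is any complex structure on any of the last four of these Lie algebras, then $V_1$ is $J$-invariant. -/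

import Mathlib

/-! ### The differential on the dual of a real Lie algebra -/

section Differential

variable (g : Type*) [LieRing g] [LieAlgebra ℝ g]

/-- The linear map `d : g* → ⋀² g*` dual to the Lie bracket, `(dσ)(X, Y) = -σ([X, Y])`; the space
`⋀² g*` is realised as the space of alternating bilinear forms on `g`. -/
def lieD : Module.Dual ℝ g →ₗ[ℝ] (g [⋀^Fin 2]→ₗ[ℝ] ℝ) where
  toFun σ :=
    { toFun := fun v => -σ ⁅v 0, v 1⁆
      map_update_add' := by
        intro _ v i x y
        fin_cases i <;> simp [Function.update] <;> ring
      map_update_smul' := by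
        intro _ v i c x
        fin_cases i <;> simp [Function.update]
      map_eq_zero_of_eq' := by
        intro v i j h hij
        have h01 : v 0 = v 1 := by
          fin_cases i <;> fin_cases j <;> simp_all
        simp [h01] }
  map_add' σ τ := by ext v; simp; ring
  map_smul' c σ := by ext v; simp

/-- `V₁ = ker d`, the space of closed `1`-forms. -/
def closedOneForms : Submodule ℝ (Module.Dual ℝ g) := LinearMap.ker (lieD g)

/-- The first Betti number `b₁ = dim H¹`, where `H¹` is the cohomology at `g*` of the complex
`0 → g* → ⋀² g* → ⋯`, that is, `ker d`. -/
noncomputable def firstBetti : ℕ := Module.finrank ℝ (closedOneForms g)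

variable {g}

/-- A complex structure on a real Lie algebra: `J² = -1` together with integrability,
`[JX, JY] = [X, Y] + J[JX, Y] + J[X, JY]`. -/
structure IsComplexStructure (J : g →ₗ[ℝ] g) : Prop where
  sq_eq : ∀ X, J (J X) = -X
  integrable : ∀ X Y, ⁅J X, J Y⁆ = ⁅X, Y⁆ + J ⁅J X, Y⁆ + J ⁅X, J Y⁆

end Differential

/-! ### Lie algebras given by structure equations -/

/-- The bracket on `ℝⁿ` determined by prescribing, for the standard dual basis `e⁰, …, eⁿ⁻¹`,
`de^i = ∑ e^j ∧ e^k`, the sum being over the pairs `(j, k)` in the list `c i`.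
As `dσ(X, Y) = -σ([X, Y])`, the `i`-th coordinate of `[x, y]` is `-∑ (x_j y_k - x_k y_j)`. -/
def structBracket {n : ℕ} (c : Fin n → List (Fin n × Fin n)) (x y : Fin n → ℝ) : Fin n → ℝ :=
  fun i => -((c i).map fun p => x p.1 * y p.2 - x p.2 * y p.1).sum

/-- Structure equations `de^i = ∑_{(j, k) ∈ form i} e^j ∧ e^k` (indices start at `0`), subject to
the Jacobi identity. -/
structure StructureEquations (n : ℕ) where
  form : Fin n → List (Fin n × Fin n)
  jacobi : ∀ x y z : Fin n → ℝ,
    structBracket form x (structBracket form y z) =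
      structBracket form (structBracket form x y) z +
        structBracket form y (structBracket form x z)

/-- The real Lie algebra with given structure equations: `ℝⁿ` with the bracket `structBracket`. -/
def StructureEquations.Algebra {n : ℕ} (_S : StructureEquations n) : Type := Fin n → ℝ

namespace StructureEquations

variable {n : ℕ} (S : StructureEquations n)

instance : AddCommGroup S.Algebra := inferInstanceAs (AddCommGroup (Fin n → ℝ))

instance : Module ℝ S.Algebra := inferInstanceAs (Module ℝ (Fin n → ℝ))

instance : Bracket S.Algebra S.Algebra := ⟨structBracket S.form⟩

instance : LieRing S.Algebra where
  add_lie x y z := by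
    funext i
    change structBracket S.form (fun j => x j + y j) z i =
      structBracket S.form x z i + structBracket S.form y z i
    simp only [structBracket]
    induction S.form i with
    | nil => simp
    | cons p l ih => simp only [List.map_cons, List.sum_cons]; linarith
  lie_add x y z := by
    funext i
    change structBracket S.form x (fun j => y j + z j) i =
      structBracket S.form x y i + structBracket S.form x z i
    simp only [structBracket]
    induction S.form i with
    | nil => simp
    | cons p l ih => simp only [List.map_cons, List.sum_cons]; linarith
  lie_self x := by
    funext i
    change structBracket S.form x x i = 0
    simp only [structBracket]
    induction S.form i with
    | nil => simp
    | cons p l ih => simp only [List.map_cons, List.sum_cons]; linarith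
  leibniz_lie x y z := S.jacobi x y z

instance : LieAlgebra ℝ S.Algebra where
  lie_smul t x y := by
    funext i
    change structBracket S.form x (fun j => t * y j) i = t * structBracket S.form x y i
    simp only [structBracket]
    induction S.form i with
    | nil => simp
    | cons p l ih => simp only [List.map_cons, List.sum_cons]; linarith

end StructureEquations

/-! ### The five Lie algebras

A tuple `(0,0,0,0,de⁵,de⁶)` in the usual notation, with `ij` for `e^i ∧ e^j` and indices `1, …, 6`,
becomes below a tuple of lists of pairs with indices `0, …, 5`. -/

/-- `(0,0,0,0,12,14+25)` -/
def nla_12_14p25 : StructureEquations 6 where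
  form := ![[], [], [], [], [(0, 1)], [(0, 3), (1, 4)]]
  jacobi x y z := by
    funext i; fin_cases i <;> simp [structBracket] <;> ring

/-- `(0,0,0,0,12,13)` -/
def nla_12_13 : StructureEquations 6 where
  form := ![[], [], [], [], [(0, 1)], [(0, 2)]]
  jacobi x y z := by
    funext i; fin_cases i <;> simp [structBracket]

/-- `(0,0,0,0,13+42,14+23)` -/
def nla_13p42_14p23 : StructureEquations 6 where
  form := ![[], [], [], [], [(0, 2), (3, 1)], [(0, 3), (1, 2)]]
  jacobi x y z := by
    funext i; fin_cases i <;> simp [structBracket]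

/-- `(0,0,0,0,12,14+23)` -/
def nla_12_14p23 : StructureEquations 6 where
  form := ![[], [], [], [], [(0, 1)], [(0, 3), (1, 2)]]
  jacobi x y z := by
    funext i; fin_cases i <;> simp [structBracket]

/-- `(0,0,0,0,12,34)` -/
def nla_12_34 : StructureEquations 6 where
  form := ![[], [], [], [], [(0, 1)], [(2, 3)]]
  jacobi x y z := by
    funext i; fin_cases i <;> simp [structBracket]

open Module

/-! With dim 𝔤 = 6 and b₁ = 4 the derived algebra D = [𝔤,𝔤], the common kernel of the closed
1-forms, is a plane. The lower central series then leaves two cases.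

If D is central, 𝔤 is determined by the plane of 2-forms dp, dq on the 4-dimensional space 𝔤/D, and
no complex structure is needed. The plane either contains a decomposable form, and then the position
of the other form gives one of three models (`isTwoStepModel_of_expansion`), or it contains none,
which gives (0,0,0,0,13+42,14+23) (`isTwoStepModel_of_normalized`).

If D is not central, [𝔤,D] is a central line, and the Jacobi identity gives a normal form with three
parameters (`exists_three_step_frame`). There J preserves the centre, whose dimension is therefore
even; this leaves only (0,0,0,0,12,14+25).

All information on J comes from one remark: for central z, integrability reads [Jx,Jz] = J[x,Jz]. So
the image of ad(Jz) is J-stable, and if it is nonzero it is all of D. Hence J preserves the centre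
or J preserves D, the latter meaning that V₁ is J-invariant. In three of the last four algebras the
centre equals D; in (0,0,0,0,12,13) the centre has odd dimension, so J cannot preserve it. Either
way V₁ is invariant. -/

theorem exists_mem_linearIndependent_cons {M : Type*} [AddCommGroup M] [Module ℝ M]
    (W : Submodule ℝ M) {n : ℕ} {v : Fin n → M} (hv : LinearIndependent ℝ v) (hm : ∀ i, v i ∈ W)
    (hn : n < finrank ℝ W) :
    ∃ x ∈ W, LinearIndependent ℝ (Fin.cons x v : Fin (n + 1) → M) := by
  obtain ⟨x, hx⟩ := exists_linearIndependent_cons_of_lt_finrank (R := ℝ) (M := W)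
    (v := fun i => ⟨v i, hm i⟩) (LinearIndependent.of_comp W.subtype hv) hn
  have h := hx.map' W.subtype (by simp)
  have e : W.subtype ∘ (Fin.cons x fun i => ⟨v i, hm i⟩ : Fin (n + 1) → W) = Fin.cons (x : M) v := by
    funext i
    refine Fin.cases ?_ (fun i => ?_) i <;> simp
  rw [e] at h
  exact ⟨x, x.2, h⟩

theorem span_range_eq_of_finrank_eq {M : Type*} [AddCommGroup M] [Module ℝ M]
    (W : Submodule ℝ M) [FiniteDimensional ℝ W] {n : ℕ} {v : Fin n → M}
    (hv : LinearIndependent ℝ v) (hm : ∀ i, v i ∈ W) (hn : n = finrank ℝ W) :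
    Submodule.span ℝ (Set.range v) = W := by
  apply Submodule.eq_of_le_of_finrank_eq
  · rw [Submodule.span_le]
    rintro _ ⟨i, rfl⟩
    exact hm i
  · rw [finrank_span_eq_card hv, ← hn]
    simp

/-! ### Closed 1-forms, the derived algebra and adapted coframes. -/

section Coframes

variable {g : Type*} [LieRing g] [LieAlgebra ℝ g]

theorem mem_closedOneForms {σ : Dual ℝ g} :
    σ ∈ closedOneForms g ↔ ∀ x y : g, σ ⁅x, y⁆ = 0 := by
  rw [closedOneForms, LinearMap.mem_ker]
  constructor
  · intro h x y
    have := congrArg (fun f : g [⋀^Fin 2]→ₗ[ℝ] ℝ => f ![x, y]) h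
    simpa [lieD] using this
  · intro h
    ext v
    simp [lieD, h]

/-- Six separating functionals satisfying structure equations give an isomorphism. -/
theorem nonempty_lieEquiv_of_coframe (hg : finrank ℝ g = 6) (S : StructureEquations 6)
    (σ : Fin 6 → Dual ℝ g) (hsep : ∀ x, (∀ i, σ i x = 0) → x = 0)
    (hbr : ∀ i x y, σ i ⁅x, y⁆ = structBracket S.form (fun j => σ j x) (fun j => σ j y) i) :
    Nonempty (g ≃ₗ⁅ℝ⁆ S.Algebra) := by
  have : FiniteDimensional ℝ g := FiniteDimensional.of_finrank_pos (by omega)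
  let T : g →ₗ[ℝ] (Fin 6 → ℝ) := LinearMap.pi σ
  have hinj : Function.Injective T := by
    rw [← LinearMap.ker_eq_bot, LinearMap.ker_eq_bot']
    intro x hx
    exact hsep x fun i => congrFun hx i
  have hbij : Function.Bijective T :=
    ⟨hinj, (LinearMap.injective_iff_surjective_of_finrank_eq_finrank (by simp [hg])).1 hinj⟩
  let F : g →ₗ⁅ℝ⁆ S.Algebra :=
    { toFun := fun x => T x
      map_add' := fun x y => T.map_add x y
      map_smul' := fun c x => T.map_smul c x
      map_lie' := fun {x y} => funext fun i => hbr i x y }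
  exact ⟨LieEquiv.ofBijective F hbij⟩

variable (g) in
/-- The common kernel of the closed `1`-forms, that is, the derived algebra `[g, g]`. -/
def closedKernel : Submodule ℝ g := (closedOneForms g).dualCoannihilator

theorem mem_closedKernel {x : g} : x ∈ closedKernel g ↔ ∀ σ ∈ closedOneForms g, σ x = 0 :=
  Submodule.mem_dualCoannihilator _

theorem lie_mem_closedKernel (x y : g) : ⁅x, y⁆ ∈ closedKernel g :=
  mem_closedKernel.2 fun _ hσ => mem_closedOneForms.1 hσ x y

theorem finrank_closedKernel (hg : finrank ℝ g = 6) (hb : firstBetti g = 4) :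
    finrank ℝ (closedKernel g) = 2 := by
  have : FiniteDimensional ℝ g := FiniteDimensional.of_finrank_pos (by omega)
  have h := Subspace.finrank_add_finrank_dualCoannihilator_eq (closedOneForms g)
  rw [firstBetti] at hb
  rw [closedKernel]
  omega

/-- Four closed `1`-forms whose common kernel is that of all closed `1`-forms. -/
structure IsClosedFrame (a b c d : Dual ℝ g) : Prop where
  mem₁ : a ∈ closedOneForms g
  mem₂ : b ∈ closedOneForms g
  mem₃ : c ∈ closedOneForms g
  mem₄ : d ∈ closedOneForms g
  sep : ∀ x, a x = 0 → b x = 0 → c x = 0 → d x = 0 → x ∈ closedKernel g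

namespace IsClosedFrame

theorem of_linearIndependent (hg : finrank ℝ g = 6) (hb : firstBetti g = 4)
    {v : Fin 4 → Dual ℝ g} (hv : LinearIndependent ℝ v) (hm : ∀ i, v i ∈ closedOneForms g) :
    IsClosedFrame (v 0) (v 1) (v 2) (v 3) := by
  have : FiniteDimensional ℝ g := FiniteDimensional.of_finrank_pos (by omega)
  have : FiniteDimensional ℝ (closedOneForms g) :=
    FiniteDimensional.finiteDimensional_submodule (closedOneForms g)
  refine ⟨hm 0, hm 1, hm 2, hm 3, fun x h0 h1 h2 h3 => ?_⟩
  rw [mem_closedKernel]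
  intro σ hσ
  rw [← span_range_eq_of_finrank_eq _ hv hm hb.symm] at hσ
  obtain ⟨k, rfl⟩ := (Submodule.mem_span_range_iff_exists_fun ℝ).1 hσ
  simp [Fin.sum_univ_four, h0, h1, h2, h3]

theorem exists_apply_eq {a b c d : Dual ℝ g} (h : IsClosedFrame a b c d)
    (hg : finrank ℝ g = 6) (hb : firstBetti g = 4) (r s t u : ℝ) :
    ∃ x, a x = r ∧ b x = s ∧ c x = t ∧ d x = u := by
  have : FiniteDimensional ℝ g := FiniteDimensional.of_finrank_pos (by omega)
  let T : g →ₗ[ℝ] (Fin 4 → ℝ) := LinearMap.pi ![a, b, c, d]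
  have hker : LinearMap.ker T ≤ closedKernel g := by
    intro x hx
    have hx' : ∀ i, ![a, b, c, d] i x = 0 := fun i => congrFun (LinearMap.mem_ker.1 hx) i
    exact h.sep x (hx' 0) (hx' 1) (hx' 2) (hx' 3)
  have h1 := Submodule.finrank_mono hker
  rw [finrank_closedKernel hg hb] at h1
  have h2 := T.finrank_range_add_finrank_ker
  have h3 := Submodule.finrank_le (LinearMap.range T)
  have h4 : finrank ℝ (Fin 4 → ℝ) = 4 := by simp
  have h5 : LinearMap.range T = ⊤ := Submodule.eq_top_of_finrank_eq (by omega)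
  obtain ⟨x, hx⟩ := LinearMap.range_eq_top.1 h5 ![r, s, t, u]
  exact ⟨x, congrFun hx 0, congrFun hx 1, congrFun hx 2, congrFun hx 3⟩

/-- An alternating form annihilated by `[g, g]` is a combination of the wedge products. -/
theorem exists_expansion {a b c d : Dual ℝ g} (h : IsClosedFrame a b c d)
    (hg : finrank ℝ g = 6) (hb : firstBetti g = 4) (ω : g →ₗ[ℝ] g →ₗ[ℝ] ℝ)
    (hω : ∀ x, ω x x = 0) (hD : ∀ x ∈ closedKernel g, ∀ y, ω x y = 0) :
    ∃ k₁₂ k₁₃ k₁₄ k₂₃ k₂₄ k₃₄ : ℝ, ∀ x y, ω x y =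
      k₁₂ * (a x * b y - b x * a y) + k₁₃ * (a x * c y - c x * a y) +
      k₁₄ * (a x * d y - d x * a y) + k₂₃ * (b x * c y - c x * b y) +
      k₂₄ * (b x * d y - d x * b y) + k₃₄ * (c x * d y - d x * c y) := by
  have hsw : ∀ x y, ω y x = -ω x y := by
    intro x y
    have := hω (x + y)
    simp [hω] at this
    linarith
  obtain ⟨A, A1, A2, A3, A4⟩ := h.exists_apply_eq hg hb 1 0 0 0
  obtain ⟨B, B1, B2, B3, B4⟩ := h.exists_apply_eq hg hb 0 1 0 0
  obtain ⟨C, C1, C2, C3, C4⟩ := h.exists_apply_eq hg hb 0 0 1 0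
  obtain ⟨E, E1, E2, E3, E4⟩ := h.exists_apply_eq hg hb 0 0 0 1
  refine ⟨ω A B, ω A C, ω A E, ω B C, ω B E, ω C E, fun x y => ?_⟩
  -- Modulo [𝔤,𝔤], which `ω` ignores, every vector is a combination of the dual vectors `A`, `B`,
  -- `C`, `E`.
  have hproj : ∀ x, x - (a x • A + b x • B + c x • C + d x • E) ∈ closedKernel g := fun x =>
    h.sep _ (by simp [A1, B1, C1, E1]) (by simp [A2, B2, C2, E2]) (by simp [A3, B3, C3, E3])
      (by simp [A4, B4, C4, E4])
  have hx : ∀ x y, ω x y = ω (a x • A + b x • B + c x • C + d x • E) y := by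
    intro x y
    have := hD _ (hproj x) y
    rw [map_sub, LinearMap.sub_apply] at this
    linarith
  rw [hx x y, hsw y, hx y, hsw]
  simp only [map_add, map_smul, LinearMap.add_apply, LinearMap.smul_apply, smul_eq_mul, hω,
    hsw A B, hsw A C, hsw A E, hsw B C, hsw B E, hsw C E]
  ring

end IsClosedFrame

theorem exists_closedFrame_cons_three (hg : finrank ℝ g = 6) (hb : firstBetti g = 4)
    {b c d : Dual ℝ g} (h : LinearIndependent ℝ ![b, c, d]) (hB : b ∈ closedOneForms g)
    (hC : c ∈ closedOneForms g) (hD : d ∈ closedOneForms g) :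
    ∃ a, IsClosedFrame a b c d := by
  have hm : ∀ i, ![b, c, d] i ∈ closedOneForms g := by
    intro i
    fin_cases i <;> assumption
  obtain ⟨a, ha, hi⟩ := exists_mem_linearIndependent_cons (closedOneForms g) h hm
    (by rw [firstBetti] at hb; rw [hb]; norm_num)
  exact ⟨a, .of_linearIndependent hg hb hi (Fin.cons ha hm)⟩

theorem exists_closedFrame_cons_two (hg : finrank ℝ g = 6) (hb : firstBetti g = 4)
    {c d : Dual ℝ g} (h : LinearIndependent ℝ ![c, d])
    (hC : c ∈ closedOneForms g) (hD : d ∈ closedOneForms g) :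
    ∃ a b, IsClosedFrame a b c d := by
  have hm : ∀ i, ![c, d] i ∈ closedOneForms g := by
    intro i
    fin_cases i <;> assumption
  obtain ⟨b, hB, hi⟩ := exists_mem_linearIndependent_cons (closedOneForms g) h hm
    (by rw [firstBetti] at hb; rw [hb]; norm_num)
  obtain ⟨a, ha⟩ := exists_closedFrame_cons_three hg hb hi hB hC hD
  exact ⟨a, b, ha⟩

theorem exists_closedFrame_cons_one (hg : finrank ℝ g = 6) (hb : firstBetti g = 4)
    {d : Dual ℝ g} (h : d ≠ 0) (hD : d ∈ closedOneForms g) :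
    ∃ a b c, IsClosedFrame a b c d := by
  have h1 : LinearIndependent ℝ ![d] := LinearIndependent.of_subsingleton 0 h
  obtain ⟨c, hC, hi⟩ := exists_mem_linearIndependent_cons (closedOneForms g) h1 (fun _ => by simpa)
    (by rw [firstBetti] at hb; rw [hb]; norm_num)
  obtain ⟨a, b, hab⟩ := exists_closedFrame_cons_two hg hb hi hC hD
  exact ⟨a, b, c, hab⟩

theorem exists_closedFrame (hg : finrank ℝ g = 6) (hb : firstBetti g = 4) :
    ∃ a b c d : Dual ℝ g, IsClosedFrame a b c d := by
  obtain ⟨d, hD, hi⟩ := exists_mem_linearIndependent_cons (closedOneForms g)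
    (v := (Fin.elim0 : Fin 0 → Dual ℝ g)) (linearIndependent_empty_type) (fun i => i.elim0)
    (by rw [firstBetti] at hb; rw [hb]; norm_num)
  obtain ⟨a, b, c, h⟩ := exists_closedFrame_cons_one hg hb (hi.ne_zero 0) hD
  exact ⟨a, b, c, d, h⟩

/-- Two functionals that restrict to a basis of the dual of `[g, g]`. -/
def IsVerticalPair (p q : Dual ℝ g) : Prop :=
  ∀ x ∈ closedKernel g, p x = 0 → q x = 0 → x = 0

/-- Otherwise `p` vanishes on the plane [𝔤,𝔤] and `q` alone embeds it in a line. This is how the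
differentials that occur below are known to be nonzero. -/
theorem IsVerticalPair.not_mem {p q : Dual ℝ g} (h : IsVerticalPair p q)
    (hg : finrank ℝ g = 6) (hb : firstBetti g = 4) : p ∉ closedOneForms g := by
  intro hp
  have : FiniteDimensional ℝ g := FiniteDimensional.of_finrank_pos (by omega)
  have hinj : Function.Injective (q.comp (closedKernel g).subtype) := by
    rw [← LinearMap.ker_eq_bot, LinearMap.ker_eq_bot']
    intro x hx
    exact Subtype.ext (h x x.2 (mem_closedKernel.1 x.2 p hp) hx)
  have := LinearMap.finrank_le_finrank_of_injective hinj
  rw [finrank_closedKernel hg hb] at this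
  simp at this

theorem exists_verticalPair (hg : finrank ℝ g = 6) (hb : firstBetti g = 4) :
    ∃ p q : Dual ℝ g, IsVerticalPair p q := by
  have : FiniteDimensional ℝ g := FiniteDimensional.of_finrank_pos (by omega)
  let v := finBasisOfFinrankEq ℝ (closedKernel g) (finrank_closedKernel hg hb)
  obtain ⟨p, hp⟩ := LinearMap.exists_extend (v.coord 0)
  obtain ⟨q, hq⟩ := LinearMap.exists_extend (v.coord 1)
  refine ⟨p, q, fun x hx h0 h1 => ?_⟩
  have e0 : v.coord 0 ⟨x, hx⟩ = 0 := by rw [← hp]; exact h0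
  have e1 : v.coord 1 ⟨x, hx⟩ = 0 := by rw [← hq]; exact h1
  have : (⟨x, hx⟩ : closedKernel g) = 0 := by
    apply v.ext_elem
    intro i
    fin_cases i
    · simpa using e0
    · simpa using e1
  exact congrArg Subtype.val this

end Coframes

/-! ### Planes of 2-forms in four variables: the 2-step algebras. -/

section TwoStep

variable {g : Type*} [LieRing g] [LieAlgebra ℝ g]

/-- Only the last two structure equations remain to be checked. `structBracket` carries the sign of
dσ = -σ[·,·], which is why the 2-step models below are reached with `-p` in place of `p`. -/
theorem nonempty_lieEquiv_of_closedFrame (hg : finrank ℝ g = 6) (S : StructureEquations 6)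
    (h0 : S.form 0 = []) (h1 : S.form 1 = []) (h2 : S.form 2 = []) (h3 : S.form 3 = [])
    {a b c d p q : Dual ℝ g} (hf : IsClosedFrame a b c d) (hv : IsVerticalPair p q)
    (hp : ∀ x y, p ⁅x, y⁆ = structBracket S.form ![a x, b x, c x, d x, p x, q x]
      ![a y, b y, c y, d y, p y, q y] 4)
    (hq : ∀ x y, q ⁅x, y⁆ = structBracket S.form ![a x, b x, c x, d x, p x, q x]
      ![a y, b y, c y, d y, p y, q y] 5) :
    Nonempty (g ≃ₗ⁅ℝ⁆ S.Algebra) := by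
  have hfun : ∀ x : g, (fun j => ![a, b, c, d, p, q] j x) = ![a x, b x, c x, d x, p x, q x] := by
    intro x
    funext j
    fin_cases j <;> rfl
  refine nonempty_lieEquiv_of_coframe hg S ![a, b, c, d, p, q] (fun x hx => ?_) (fun i x y => ?_)
  · exact hv x (hf.sep x (hx 0) (hx 1) (hx 2) (hx 3)) (hx 4) (hx 5)
  · rw [hfun, hfun]
    fin_cases i
    · simpa [structBracket, h0] using mem_closedOneForms.1 hf.mem₁ x y
    · simpa [structBracket, h1] using mem_closedOneForms.1 hf.mem₂ x y
    · simpa [structBracket, h2] using mem_closedOneForms.1 hf.mem₃ x y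
    · simpa [structBracket, h3] using mem_closedOneForms.1 hf.mem₄ x y
    · exact hp x y
    · exact hq x y

variable (g) in
/-- `g` is isomorphic to one of the four `2`-step algebras. -/
def IsTwoStepModel : Prop :=
  Nonempty (g ≃ₗ⁅ℝ⁆ nla_12_13.Algebra) ∨
  Nonempty (g ≃ₗ⁅ℝ⁆ nla_13p42_14p23.Algebra) ∨
  Nonempty (g ≃ₗ⁅ℝ⁆ nla_12_14p23.Algebra) ∨
  Nonempty (g ≃ₗ⁅ℝ⁆ nla_12_34.Algebra)

theorem IsClosedFrame.exists_lie_expansion {a b c d : Dual ℝ g} (h : IsClosedFrame a b c d)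
    (hg : finrank ℝ g = 6) (hb : firstBetti g = 4)
    (h2 : ∀ x ∈ closedKernel g, ∀ y : g, ⁅x, y⁆ = 0) (p : Dual ℝ g) :
    ∃ k₁₂ k₁₃ k₁₄ k₂₃ k₂₄ k₃₄ : ℝ, ∀ x y, p ⁅x, y⁆ =
      k₁₂ * (a x * b y - b x * a y) + k₁₃ * (a x * c y - c x * a y) +
      k₁₄ * (a x * d y - d x * a y) + k₂₃ * (b x * c y - c x * b y) +
      k₂₄ * (b x * d y - d x * b y) + k₃₄ * (c x * d y - d x * c y) :=
  h.exists_expansion hg hb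
    (LinearMap.mk₂ ℝ (fun x y : g => p ⁅x, y⁆) (by simp) (by simp) (by simp) (by simp))
    (by simp) (fun x hx y => by simp [h2 x hx y])

/-- Case of a decomposable differential `dp = -a ∧ b`. -/
theorem isTwoStepModel_of_expansion (hg : finrank ℝ g = 6) (hb : firstBetti g = 4)
    {a b c d p q : Dual ℝ g} (hf : IsClosedFrame a b c d) (hv : IsVerticalPair p q)
    (hp : ∀ x y, p ⁅x, y⁆ = a x * b y - b x * a y) {k₁₂ k₁₃ k₁₄ k₂₃ k₂₄ k₃₄ : ℝ}
    (hq : ∀ x y, q ⁅x, y⁆ =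
      k₁₂ * (a x * b y - b x * a y) + k₁₃ * (a x * c y - c x * a y) +
      k₁₄ * (a x * d y - d x * a y) + k₂₃ * (b x * c y - c x * b y) +
      k₂₄ * (b x * d y - d x * b y) + k₃₄ * (c x * d y - d x * c y)) : IsTwoStepModel g := by
  -- As dp = -a∧b, `k₃₄` is up to sign the coefficient of dp∧dq. When it vanishes, dq is, up to sign
  -- and modulo dp, a∧(k₁₃c + k₁₄d) + b∧(k₂₃c + k₂₄d), and the rank of this 2×2 matrix decides.
  by_cases h34 : k₃₄ = 0
  · by_cases hdet : k₁₃ * k₂₄ - k₁₄ * k₂₃ = 0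
    -- A singular 2×2 matrix is a column times a row, so the form above is (ua + u'b)∧(vc + v'd).
    · obtain ⟨u, u', v, v', e13, e14, e23, e24⟩ : ∃ u u' v v' : ℝ,
          k₁₃ = u * v ∧ k₁₄ = u * v' ∧ k₂₃ = u' * v ∧ k₂₄ = u' * v' := by
        by_cases h13 : k₁₃ = 0
        · by_cases h14 : k₁₄ = 0
          · exact ⟨0, 1, k₂₃, k₂₄, by simp [h13], by simp [h14], by simp, by simp⟩
          · refine ⟨1, k₂₄ / k₁₄, k₁₃, k₁₄, by simp, by simp, ?_, by field_simp⟩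
            have : k₂₃ = 0 := by
              rw [h13] at hdet
              have : k₁₄ * k₂₃ = 0 := by linarith
              exact (mul_eq_zero.1 this).resolve_left h14
            simp [this, h13]
        · refine ⟨1, k₂₃ / k₁₃, k₁₃, k₁₄, by simp, by simp, by field_simp, ?_⟩
          field_simp
          linarith
      have hne : ¬ (k₁₃ = 0 ∧ k₁₄ = 0 ∧ k₂₃ = 0 ∧ k₂₄ = 0) := by
        rintro ⟨z1, z2, z3, z4⟩
        have hv' : IsVerticalPair (q - k₁₂ • p) p := fun x hx h1 h2 =>
          hv x hx h2 (by simpa [h2] using h1)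
        refine hv'.not_mem hg hb (mem_closedOneForms.2 fun x y => ?_)
        simp [hp, hq, z1, z2, z3, z4, h34]
      have hu : u ^ 2 + u' ^ 2 ≠ 0 := by
        intro h
        have h1 : u = 0 := by nlinarith [sq_nonneg u, sq_nonneg u']
        have h2 : u' = 0 := by nlinarith [sq_nonneg u, sq_nonneg u']
        exact hne (by simp [e13, e14, e23, e24, h1, h2])
      have hw : v ^ 2 + v' ^ 2 ≠ 0 := by
        intro h
        have h1 : v = 0 := by nlinarith [sq_nonneg v, sq_nonneg v']
        have h2 : v' = 0 := by nlinarith [sq_nonneg v, sq_nonneg v']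
        exact hne (by simp [e13, e14, e23, e24, h1, h2])
      -- The second form is scaled so that its wedge with ua + u'b is again a∧b; the fourth is the
      -- rotation of the third.
      refine Or.inl (nonempty_lieEquiv_of_closedFrame hg nla_12_13 rfl rfl rfl rfl
        (a := u • a + u' • b) (b := (u ^ 2 + u' ^ 2)⁻¹ • (u • b - u' • a))
        (c := v • c + v' • d) (d := v • d - v' • c) (p := -p) (q := k₁₂ • p - q)
        ⟨?_, ?_, ?_, ?_, fun x h1 h2 h3 h4 => ?_⟩ (fun x hx h1 h2 => ?_) ?_ ?_)
      · exact add_mem (Submodule.smul_mem _ _ hf.mem₁) (Submodule.smul_mem _ _ hf.mem₂)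
      · exact Submodule.smul_mem _ _ (sub_mem (Submodule.smul_mem _ _ hf.mem₂)
          (Submodule.smul_mem _ _ hf.mem₁))
      · exact add_mem (Submodule.smul_mem _ _ hf.mem₃) (Submodule.smul_mem _ _ hf.mem₄)
      · exact sub_mem (Submodule.smul_mem _ _ hf.mem₄) (Submodule.smul_mem _ _ hf.mem₃)
      · simp [hu] at h1 h2 h3 h4
        have A : (u ^ 2 + u' ^ 2) * a x = 0 := by linear_combination u * h1 - u' * h2
        have B : (u ^ 2 + u' ^ 2) * b x = 0 := by linear_combination u' * h1 + u * h2
        have C : (v ^ 2 + v' ^ 2) * c x = 0 := by linear_combination v * h3 - v' * h4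
        have D : (v ^ 2 + v' ^ 2) * d x = 0 := by linear_combination v' * h3 + v * h4
        exact hf.sep x ((mul_eq_zero.1 A).resolve_left hu) ((mul_eq_zero.1 B).resolve_left hu)
          ((mul_eq_zero.1 C).resolve_left hw) ((mul_eq_zero.1 D).resolve_left hw)
      · have h3 : p x = 0 := by simpa using h1
        exact hv x hx h3 (by simpa [h3] using h2)
      · intro x y
        simp [structBracket, nla_12_13, hp]
        field_simp
        ring
      · intro x y
        simp [structBracket, nla_12_13, hp, hq, e13, e14, e23, e24, h34]
        ring
    · refine Or.inr (Or.inr (Or.inl (nonempty_lieEquiv_of_closedFrame hg nla_12_14p23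
        rfl rfl rfl rfl (a := a) (b := b) (c := k₂₃ • c + k₂₄ • d) (d := k₁₃ • c + k₁₄ • d)
        (p := -p) (q := k₁₂ • p - q)
        ⟨hf.mem₁, hf.mem₂, ?_, ?_, fun x h1 h2 h3 h4 => ?_⟩ (fun x hx h1 h2 => ?_) ?_ ?_)))
      · exact add_mem (Submodule.smul_mem _ _ hf.mem₃) (Submodule.smul_mem _ _ hf.mem₄)
      · exact add_mem (Submodule.smul_mem _ _ hf.mem₃) (Submodule.smul_mem _ _ hf.mem₄)
      · simp at h3 h4
        have C : (k₁₃ * k₂₄ - k₁₄ * k₂₃) * c x = 0 := by linear_combination k₂₄ * h4 - k₁₄ * h3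
        have D : (k₁₃ * k₂₄ - k₁₄ * k₂₃) * d x = 0 := by linear_combination k₁₃ * h3 - k₂₃ * h4
        exact hf.sep x h1 h2 ((mul_eq_zero.1 C).resolve_left hdet)
          ((mul_eq_zero.1 D).resolve_left hdet)
      · have h3 : p x = 0 := by simpa using h1
        exact hv x hx h3 (by simpa [h3] using h2)
      · intro x y
        simp [structBracket, nla_12_14p23, hp]
      · intro x y
        simp [structBracket, nla_12_14p23, hp, hq, h34]
        ring
  -- The new third and fourth forms have product k₃₄ c∧d plus all mixed terms; the leftover multiple
  -- of a∧b is absorbed in the multiple of `p` in the last form.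
  · refine Or.inr (Or.inr (Or.inr (nonempty_lieEquiv_of_closedFrame hg nla_12_34
      rfl rfl rfl rfl (a := a) (b := b) (c := k₃₄ • c + (k₁₄ • a + k₂₄ • b))
      (d := d - k₃₄⁻¹ • (k₁₃ • a + k₂₃ • b))
      (p := -p) (q := (k₁₂ + k₃₄⁻¹ * (k₁₄ * k₂₃ - k₁₃ * k₂₄)) • p - q)
      ⟨hf.mem₁, hf.mem₂, ?_, ?_, fun x h1 h2 h3 h4 => ?_⟩ (fun x hx h1 h2 => ?_) ?_ ?_)))
    · exact add_mem (Submodule.smul_mem _ _ hf.mem₃) (add_mem (Submodule.smul_mem _ _ hf.mem₁)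
        (Submodule.smul_mem _ _ hf.mem₂))
    · exact sub_mem hf.mem₄ (Submodule.smul_mem _ _ (add_mem (Submodule.smul_mem _ _ hf.mem₁)
        (Submodule.smul_mem _ _ hf.mem₂)))
    · exact hf.sep x h1 h2 (by simpa [h1, h2, h34] using h3) (by simpa [h1, h2] using h4)
    · have h3 : p x = 0 := by simpa using h1
      exact hv x hx h3 (by simpa [h3] using h2)
    · intro x y
      simp [structBracket, nla_12_34, hp]
    · intro x y
      simp [structBracket, nla_12_34, hp, hq]
      field_simp
      ring

/-- Since dp ≠ 0, the two factors are independent: wedging a relation sa + tb = 0 with either factor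
kills s and t. They therefore extend to a closed frame. -/
theorem isTwoStepModel_of_decomposable (hg : finrank ℝ g = 6) (hb : firstBetti g = 4)
    (h2 : ∀ x ∈ closedKernel g, ∀ y : g, ⁅x, y⁆ = 0)
    {a b p q : Dual ℝ g} (hv : IsVerticalPair p q)
    (ha : a ∈ closedOneForms g) (hB : b ∈ closedOneForms g)
    (hp : ∀ x y, p ⁅x, y⁆ = a x * b y - b x * a y) : IsTwoStepModel g := by
  have hi : LinearIndependent ℝ ![a, b] := by
    rw [LinearIndependent.pair_iff]
    intro s t hst
    have e : ∀ x, s * a x + t * b x = 0 := fun x => by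
      simpa using congrArg (fun f : Dual ℝ g => f x) hst
    have key : ∀ r : ℝ, (∀ x y, r * (a x * b y - b x * a y) = 0) → r = 0 := by
      intro r hr
      by_contra hne
      refine hv.not_mem hg hb (mem_closedOneForms.2 fun x y => ?_)
      rw [hp]
      exact (mul_eq_zero.1 (hr x y)).resolve_left hne
    exact ⟨key s fun x y => by linear_combination b y * e x - b x * e y,
      key t fun x y => by linear_combination a x * e y - a y * e x⟩
  obtain ⟨c, d, hf⟩ := exists_closedFrame_cons_two hg hb hi ha hB
  have hf' : IsClosedFrame a b c d :=
    ⟨hf.mem₃, hf.mem₄, hf.mem₁, hf.mem₂, fun x h1 h2 h3 h4 => hf.sep x h3 h4 h1 h2⟩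
  obtain ⟨_, _, _, _, _, _, hq⟩ := hf'.exists_lie_expansion hg hb h2 q
  exact isTwoStepModel_of_expansion hg hb hf' hv hp hq

/-- A 2-form in three variables is always decomposable. -/
theorem isTwoStepModel_of_three (hg : finrank ℝ g = 6) (hb : firstBetti g = 4)
    (h2 : ∀ x ∈ closedKernel g, ∀ y : g, ⁅x, y⁆ = 0)
    {b c d p q : Dual ℝ g} (hv : IsVerticalPair p q)
    (hB : b ∈ closedOneForms g) (hC : c ∈ closedOneForms g) (hD : d ∈ closedOneForms g)
    {k l m : ℝ} (hp : ∀ x y, p ⁅x, y⁆ = k * (b x * c y - c x * b y) +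
      l * (b x * d y - d x * b y) + m * (c x * d y - d x * c y)) : IsTwoStepModel g := by
  by_cases hm : m = 0
  · refine isTwoStepModel_of_decomposable hg hb h2 (a := b) (b := k • c + l • d) hv hB
      (add_mem (Submodule.smul_mem _ _ hC) (Submodule.smul_mem _ _ hD)) fun x y => ?_
    simp [hp, hm]
    ring
  · refine isTwoStepModel_of_decomposable hg hb h2 (a := m • c + l • b) (b := d - (k / m) • b) hv
      (add_mem (Submodule.smul_mem _ _ hC) (Submodule.smul_mem _ _ hB))
      (sub_mem hD (Submodule.smul_mem _ _ hB)) fun x y => ?_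
    simp [hp]
    field_simp
    ring

/-- The form of q + λp is (a + (t-λ)b)∧(d + λc) as soon as λ² - tλ + s = 0. So the sign of t² - 4s
decides whether this real factorisation is available. -/
theorem isTwoStepModel_of_normalized (hg : finrank ℝ g = 6) (hb : firstBetti g = 4)
    (h2 : ∀ x ∈ closedKernel g, ∀ y : g, ⁅x, y⁆ = 0)
    {a b c d p q : Dual ℝ g} (hf : IsClosedFrame a b c d) (hv : IsVerticalPair p q) {s t : ℝ}
    (hp : ∀ x y, p ⁅x, y⁆ = (a x * c y - c x * a y) - (b x * d y - d x * b y))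
    (hq : ∀ x y, q ⁅x, y⁆ = (a x * d y - d x * a y) + s * (b x * c y - c x * b y) +
      t * (b x * d y - d x * b y)) : IsTwoStepModel g := by
  by_cases hs : 4 * s ≤ t ^ 2
  · set r := Real.sqrt (t ^ 2 - 4 * s)
    have hr : r ^ 2 = t ^ 2 - 4 * s := Real.sq_sqrt (by linarith)
    have hv' : IsVerticalPair (q + ((t + r) / 2) • p) p := fun x hx h1 h3 =>
      hv x hx h3 (by simpa [h3] using h1)
    refine isTwoStepModel_of_decomposable hg hb h2 (a := a + (t - (t + r) / 2) • b)
      (b := d + ((t + r) / 2) • c) hv' (add_mem hf.mem₁ (Submodule.smul_mem _ _ hf.mem₂))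
      (add_mem hf.mem₄ (Submodule.smul_mem _ _ hf.mem₃)) fun x y => ?_
    simp [hp, hq]
    linear_combination (b x * c y - c x * b y) / 4 * hr
  · push Not at hs
    set m := Real.sqrt (s - t ^ 2 / 4)
    have hm : m ^ 2 = s - t ^ 2 / 4 := Real.sq_sqrt (by linarith)
    have hm0 : m ≠ 0 := by
      intro h
      rw [h] at hm
      linarith
    -- Completing the square with λ = t/2 leaves (a + (t/2)b)∧(d + (t/2)c) + m² b∧c; the factor m is
    -- then distributed between the second and the fourth form.
    refine Or.inr (Or.inl (nonempty_lieEquiv_of_closedFrame hg nla_13p42_14p23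
      rfl rfl rfl rfl (a := a + (t / 2) • b) (b := m • b) (c := c)
      (d := m⁻¹ • (d + (t / 2) • c)) (p := -p) (q := -(m⁻¹ • (q + (t / 2) • p)))
      ⟨?_, ?_, hf.mem₃, ?_, fun x h1 h2 h3 h4 => ?_⟩ (fun x hx h1 h2 => ?_) ?_ ?_))
    · exact add_mem hf.mem₁ (Submodule.smul_mem _ _ hf.mem₂)
    · exact Submodule.smul_mem _ _ hf.mem₂
    · exact Submodule.smul_mem _ _ (add_mem hf.mem₄ (Submodule.smul_mem _ _ hf.mem₃))
    · have B : b x = 0 := by simpa [hm0] using h2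
      exact hf.sep x (by simpa [B] using h1) B h3 (by simpa [h3, hm0] using h4)
    · have h3 : p x = 0 := by simpa using h1
      exact hv x hx h3 (by simpa [h3, hm0] using h2)
    · intro x y
      simp [structBracket, nla_13p42_14p23, hp]
      field_simp
      ring
    · intro x y
      simp [structBracket, nla_13p42_14p23, hp, hq]
      field_simp
      rw [hm]
      ring

/-- Replacing a by a + r₁b - r₃d + s₃c absorbs the b∧c and c∧d terms of p and the c∧d term of q, at
the price of changing s₂ to s₂ - r₁. -/
theorem isTwoStepModel_of_partially_normalized (hg : finrank ℝ g = 6) (hb : firstBetti g = 4)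
    (h2 : ∀ x ∈ closedKernel g, ∀ y : g, ⁅x, y⁆ = 0)
    {a b c d p q : Dual ℝ g} (hf : IsClosedFrame a b c d) (hv : IsVerticalPair p q)
    {r₁ r₂ r₃ s₁ s₂ s₃ : ℝ}
    (hp : ∀ x y, p ⁅x, y⁆ = (a x * c y - c x * a y) + r₁ * (b x * c y - c x * b y) +
      r₂ * (b x * d y - d x * b y) + r₃ * (c x * d y - d x * c y))
    (hq : ∀ x y, q ⁅x, y⁆ = (a x * d y - d x * a y) + s₁ * (b x * c y - c x * b y) +
      s₂ * (b x * d y - d x * b y) + s₃ * (c x * d y - d x * c y)) : IsTwoStepModel g := by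
  have hA : a + r₁ • b - r₃ • d + s₃ • c ∈ closedOneForms g :=
    add_mem (sub_mem (add_mem hf.mem₁ (Submodule.smul_mem _ _ hf.mem₂))
      (Submodule.smul_mem _ _ hf.mem₄)) (Submodule.smul_mem _ _ hf.mem₃)
  by_cases hr : r₂ = 0
  · refine isTwoStepModel_of_decomposable hg hb h2 (a := a + r₁ • b - r₃ • d + s₃ • c) (b := c)
      hv hA hf.mem₃ fun x y => ?_
    simp [hp, hr]
    ring
  · refine isTwoStepModel_of_normalized hg hb h2 (a := a + r₁ • b - r₃ • d + s₃ • c)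
      (b := -(r₂ • b)) (c := c) (d := d) (s := -(s₁ / r₂)) (t := -((s₂ - r₁) / r₂))
      ⟨hA, ?_, hf.mem₃, hf.mem₄, fun x h1 h2 h3 h4 => ?_⟩ hv ?_ ?_
    · exact neg_mem (Submodule.smul_mem _ _ hf.mem₂)
    · have B : b x = 0 := by simpa [hr] using h2
      exact hf.sep x (by simpa [B, h3, h4] using h1) B h3 h4
    · intro x y
      simp [hp]
      ring
    · intro x y
      simp [hq]
      field_simp
      ring

/-- Classification of the `2`-step nilpotent algebras. -/
theorem isTwoStepModel_of_closedKernel_central (hg : finrank ℝ g = 6) (hb : firstBetti g = 4)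
    (h2 : ∀ x ∈ closedKernel g, ∀ y : g, ⁅x, y⁆ = 0) : IsTwoStepModel g := by
  obtain ⟨p, q, hv⟩ := exists_verticalPair hg hb
  obtain ⟨a, b, c, d, hf⟩ := exists_closedFrame hg hb
  obtain ⟨p₁₂, p₁₃, p₁₄, p₂₃, p₂₄, p₃₄, hp⟩ := hf.exists_lie_expansion hg hb h2 p
  obtain ⟨q₁₂, q₁₃, q₁₄, q₂₃, q₂₄, q₃₄, hq⟩ := hf.exists_lie_expansion hg hb h2 q
  obtain ⟨E, E1, E2, E3, E4⟩ := hf.exists_apply_eq hg hb 1 0 0 0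
  -- `θ` and `η` are the contractions of the two 2-forms with the vector `E` dual to `a`.
  set θ : Dual ℝ g := p₁₂ • b + p₁₃ • c + p₁₄ • d with hθ
  set η : Dual ℝ g := q₁₂ • b + q₁₃ • c + q₁₄ • d with hη
  have hθm : θ ∈ closedOneForms g := add_mem (add_mem (Submodule.smul_mem _ _ hf.mem₂)
    (Submodule.smul_mem _ _ hf.mem₃)) (Submodule.smul_mem _ _ hf.mem₄)
  have hηm : η ∈ closedOneForms g := add_mem (add_mem (Submodule.smul_mem _ _ hf.mem₂)
    (Submodule.smul_mem _ _ hf.mem₃)) (Submodule.smul_mem _ _ hf.mem₄)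
  have hpE : ∀ y, p ⁅E, y⁆ = θ y := fun y => by simp [hp, E1, E2, E3, E4, hθ]
  have hqE : ∀ y, q ⁅E, y⁆ = η y := fun y => by simp [hq, E1, E2, E3, E4, hη]
  have θE : θ E = 0 := by rw [← hpE]; simp
  have ηE : η E = 0 := by rw [← hqE]; simp
  by_cases hi : ∀ s t : ℝ, (∀ y, s * θ y + t * η y = 0) → s = 0 ∧ t = 0
  · have hi3 : LinearIndependent ℝ ![a, θ, η] := by
      rw [Fintype.linearIndependent_iff]
      intro k hk
      have e : ∀ x, k 0 * a x + k 1 * θ x + k 2 * η x = 0 := fun x => by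
        simpa [Fin.sum_univ_three] using congrArg (fun f : Dual ℝ g => f x) hk
      have k0 : k 0 = 0 := by simpa [E1, θE, ηE] using e E
      obtain ⟨k1, k2⟩ := hi (k 1) (k 2) fun y => by simpa [k0] using e y
      intro i
      fin_cases i <;> assumption
    obtain ⟨β, hβ⟩ := exists_closedFrame_cons_three hg hb hi3 hf.mem₁ hθm hηm
    have hf' : IsClosedFrame a (β - β E • a) θ η :=
      ⟨hf.mem₁, sub_mem hβ.mem₁ (Submodule.smul_mem _ _ hf.mem₁), hθm, hηm,
        fun x h1 h2 h3 h4 => hβ.sep x (by simpa [h1] using h2) h1 h3 h4⟩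
    -- In the frame a, γ, θ, η only `a` is nonzero on `E`, so contracting with `E` again reads off
    -- the coefficients: p begins with a∧θ and q with a∧η.
    have βE : (β - β E • a) E = 0 := by simp [E1]
    generalize β - β E • a = γ at hf' βE
    obtain ⟨k₁₂, k₁₃, k₁₄, k₂₃, k₂₄, k₃₄, hp'⟩ := hf'.exists_lie_expansion hg hb h2 p
    obtain ⟨l₁₂, l₁₃, l₁₄, l₂₃, l₂₄, l₃₄, hq'⟩ := hf'.exists_lie_expansion hg hb h2 q
    have ep : ∀ y, θ y = k₁₂ * γ y + k₁₃ * θ y + k₁₄ * η y := fun y => by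
      have h := hp' E y
      rw [hpE, E1, βE, θE, ηE] at h
      linear_combination h
    have eq : ∀ y, η y = l₁₂ * γ y + l₁₃ * θ y + l₁₄ * η y := fun y => by
      have h := hq' E y
      rw [hqE, E1, βE, θE, ηE] at h
      linear_combination h
    obtain ⟨X, -, X2, X3, X4⟩ := hf'.exists_apply_eq hg hb 0 1 0 0
    obtain ⟨Y, -, Y2, Y3, Y4⟩ := hf'.exists_apply_eq hg hb 0 0 1 0
    obtain ⟨Z, -, Z2, Z3, Z4⟩ := hf'.exists_apply_eq hg hb 0 0 0 1
    have a1 : k₁₂ = 0 := by simpa [X2, X3, X4] using (ep X).symm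
    have a2 : k₁₃ = 1 := by simpa [Y2, Y3, Y4] using (ep Y).symm
    have a3 : k₁₄ = 0 := by simpa [Z2, Z3, Z4] using (ep Z).symm
    have b1 : l₁₂ = 0 := by simpa [X2, X3, X4] using (eq X).symm
    have b2 : l₁₃ = 0 := by simpa [Y2, Y3, Y4] using (eq Y).symm
    have b3 : l₁₄ = 1 := by simpa [Z2, Z3, Z4] using (eq Z).symm
    exact isTwoStepModel_of_partially_normalized hg hb h2 hf' hv
      (r₁ := k₂₃) (r₂ := k₂₄) (r₃ := k₃₄) (s₁ := l₂₃) (s₂ := l₂₄) (s₃ := l₃₄)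
      (fun x y => by rw [hp', a1, a2, a3]; ring) (fun x y => by rw [hq', b1, b2, b3]; ring)
  · push Not at hi
    obtain ⟨s, t, hst, hne⟩ := hi
    -- A relation between the contractions removes `a` from the form of sp + tq, which then involves
    -- only three variables.
    have hexp : ∀ x y, (s • p + t • q) ⁅x, y⁆ =
        (s * p₂₃ + t * q₂₃) * (b x * c y - c x * b y) +
        (s * p₂₄ + t * q₂₄) * (b x * d y - d x * b y) +
        (s * p₃₄ + t * q₃₄) * (c x * d y - d x * c y) := by
      intro x y
      have h1 := hst x
      have h3 := hst y
      simp [hθ, hη] at h1 h3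
      simp [hp, hq]
      linear_combination a x * h3 - a y * h1
    by_cases hs : s = 0
    · have ht := hne hs
      refine isTwoStepModel_of_three hg hb h2 (q := p) (fun x hx h1 h3 => ?_)
        hf.mem₂ hf.mem₃ hf.mem₄ hexp
      exact hv x hx h3 (by simpa [h3, ht] using h1)
    · refine isTwoStepModel_of_three hg hb h2 (q := q) (fun x hx h1 h3 => ?_)
        hf.mem₂ hf.mem₃ hf.mem₄ hexp
      exact hv x hx (by simpa [h3, hs] using h1) h3

end TwoStep

/-! ### Complex structures, the centre and the derived algebra. -/

section ComplexStructure

variable {g : Type*} [LieRing g] [LieAlgebra ℝ g]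

namespace IsComplexStructure

variable {J : g →ₗ[ℝ] g}

/-- Two of the three terms of the integrability condition contain a bracket with `z`. Consequently
the image of ad(Jz) is J-stable, the fact on which every use of J rests. -/
theorem lie_apply_of_central (hJ : IsComplexStructure J) {z : g} (hz : ∀ x : g, ⁅x, z⁆ = 0) (x : g) :
    ⁅J x, J z⁆ = J ⁅x, J z⁆ := by
  rw [hJ.integrable, hz, hz]
  simp

theorem eq_zero_of_apply_eq_smul (hJ : IsComplexStructure J) {x : g} {r : ℝ} (h : J x = r • x) :
    x = 0 := by
  have h1 := hJ.sq_eq x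
  rw [h, map_smul, h, smul_smul] at h1
  have h2 : (r * r + 1) • x = 0 := by rw [add_smul, h1]; simp
  exact (smul_eq_zero.1 h2).resolve_left (by nlinarith [mul_self_nonneg r])

/-- The square of the determinant of J on N is (-1)^dim N. -/
theorem even_finrank (hJ : IsComplexStructure J) (N : Submodule ℝ g) (hN : ∀ x ∈ N, J x ∈ N) :
    Even (finrank ℝ N) := by
  let K := J.restrict hN
  have hK : K * K = (-1 : ℝ) • LinearMap.id := by
    ext x
    simp [K, hJ.sq_eq]
  have h := congrArg LinearMap.det hK
  rw [map_mul, LinearMap.det_smul, LinearMap.det_id, mul_one] at h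
  by_contra hodd
  rw [Nat.not_even_iff_odd] at hodd
  rw [hodd.neg_one_pow] at h
  nlinarith [mul_self_nonneg (LinearMap.det K)]

/-- If `z` is central and `J z` is not, then the image of `ad (J z)` fills every plane that
contains the derived algebra. -/
theorem exists_eq_lie (hJ : IsComplexStructure J) {z : g} (hz : ∀ x : g, ⁅x, z⁆ = 0)
    {w : g} (hw : ⁅w, J z⁆ ≠ 0) (K : Submodule ℝ g) (hK : finrank ℝ K = 2)
    (hlie : ∀ x y : g, ⁅x, y⁆ ∈ K) {k : g} (hk : k ∈ K) : ∃ x : g, k = ⁅x, J z⁆ := by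
  set v := ⁅w, J z⁆
  have hJv : J v = ⁅J w, J z⁆ := (hJ.lie_apply_of_central hz w).symm
  -- J has no real eigenvector, so v and Jv, both brackets with Jz, span the plane.
  have hi : LinearIndependent ℝ ![v, J v] := by
    rw [LinearIndependent.pair_iff' hw]
    intro a ha
    exact hw (hJ.eq_zero_of_apply_eq_smul ha.symm)
  have : FiniteDimensional ℝ K := FiniteDimensional.of_finrank_pos (by omega)
  have hs := span_range_eq_of_finrank_eq K hi
    (fun i => by fin_cases i; exacts [hlie _ _, by simpa [hJv] using hlie (J w) (J z)]) hK.symm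
  rw [← hs] at hk
  obtain ⟨c, rfl⟩ := (Submodule.mem_span_range_iff_exists_fun ℝ).1 hk
  refine ⟨c 0 • w + c 1 • J w, ?_⟩
  simp [Fin.sum_univ_two, hJv, v]

theorem apply_mem_of_not_central (hJ : IsComplexStructure J) {z : g} (hz : ∀ x : g, ⁅x, z⁆ = 0)
    {w : g} (hw : ⁅w, J z⁆ ≠ 0) (K : Submodule ℝ g) (hK : finrank ℝ K = 2)
    (hlie : ∀ x y : g, ⁅x, y⁆ ∈ K) {k : g} (hk : k ∈ K) : ∃ x y : g, J k = ⁅x, y⁆ := by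
  obtain ⟨x, rfl⟩ := hJ.exists_eq_lie hz hw K hK hlie hk
  exact ⟨J x, J z, (hJ.lie_apply_of_central hz x).symm⟩

end IsComplexStructure

/-- A surjection from a `6`-dimensional space onto `ℝⁿ` has kernel of dimension `6 - n`. -/
theorem finrank_ker_of_surjective (hg : finrank ℝ g = 6) {n : ℕ} (T : g →ₗ[ℝ] (Fin n → ℝ))
    (hT : Function.Surjective T) : n + finrank ℝ (LinearMap.ker T) = 6 := by
  have : FiniteDimensional ℝ g := FiniteDimensional.of_finrank_pos (by omega)
  have h := T.finrank_range_add_finrank_ker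
  rw [LinearMap.range_eq_top.2 hT, finrank_top, hg] at h
  simpa using h

theorem exists_coframe_apply_eq (hg : finrank ℝ g = 6) {a b c d p q : Dual ℝ g}
    (hf : IsClosedFrame a b c d) (hv : IsVerticalPair p q) (r : Fin 6 → ℝ) :
    ∃ x, a x = r 0 ∧ b x = r 1 ∧ c x = r 2 ∧ d x = r 3 ∧ p x = r 4 ∧ q x = r 5 := by
  have : FiniteDimensional ℝ g := FiniteDimensional.of_finrank_pos (by omega)
  let T : g →ₗ[ℝ] (Fin 6 → ℝ) := LinearMap.pi ![a, b, c, d, p, q]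
  have hinj : Function.Injective T := by
    rw [← LinearMap.ker_eq_bot, LinearMap.ker_eq_bot']
    intro x hx
    have h : ∀ i, ![a, b, c, d, p, q] i x = 0 := fun i => congrFun hx i
    exact hv x (hf.sep x (h 0) (h 1) (h 2) (h 3)) (h 4) (h 5)
  obtain ⟨x, hx⟩ :=
    (LinearMap.injective_iff_surjective_of_finrank_eq_finrank (by simp [hg])).1 hinj r
  exact ⟨x, congrFun hx 0, congrFun hx 1, congrFun hx 2, congrFun hx 3, congrFun hx 4,
    congrFun hx 5⟩

/-- In the `3`-step case, a complex structure preserves the centre. -/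
theorem IsComplexStructure.central_apply (hg : finrank ℝ g = 6) (hb : firstBetti g = 4)
    {a b c d τ ρ : Dual ℝ g} (hf : IsClosedFrame a b c d) (hv : IsVerticalPair τ ρ)
    {k l m : ℝ} (hτ : ∀ x y, τ ⁅x, y⁆ = a x * b y - b x * a y)
    (hρ : ∀ x y, ρ ⁅x, y⁆ = (τ x * a y - a x * τ y) + k * (b x * c y - c x * b y) +
      l * (b x * d y - d x * b y) + m * (c x * d y - d x * c y))
    {J : g →ₗ[ℝ] g} (hJ : IsComplexStructure J) {z : g} (hz : ∀ x : g, ⁅x, z⁆ = 0) (w : g) :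
    ⁅w, J z⁆ = 0 := by
  by_contra hw
  have hD : ∀ x ∈ closedKernel g, a x = 0 ∧ b x = 0 ∧ c x = 0 ∧ d x = 0 := fun x hx =>
    ⟨mem_closedKernel.1 hx a hf.mem₁, mem_closedKernel.1 hx b hf.mem₂,
      mem_closedKernel.1 hx c hf.mem₃, mem_closedKernel.1 hx d hf.mem₄⟩
  have hK := finrank_closedKernel hg hb
  -- `E` and `F` span [𝔤,𝔤]; `E` is central and `F` is not. If J moves some central vector out of
  -- the centre, then it preserves [𝔤,𝔤], so `J E` lies there.
  obtain ⟨E, E1, E2, E3, E4, E5, E6⟩ := exists_coframe_apply_eq hg hf hv ![0, 0, 0, 0, 0, 1]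
  obtain ⟨F, F1, F2, F3, F4, F5, F6⟩ := exists_coframe_apply_eq hg hf hv ![0, 0, 0, 0, 1, 0]
  simp at E1 E2 E3 E4 E5 E6 F1 F2 F3 F4 F5 F6
  have hE : E ∈ closedKernel g := hf.sep E E1 E2 E3 E4
  have hF : F ∈ closedKernel g := hf.sep F F1 F2 F3 F4
  have hEc : ∀ x : g, ⁅x, E⁆ = 0 := fun x => hv _ (lie_mem_closedKernel _ _)
    (by simp [hτ, E1, E2]) (by simp [hρ, E1, E2, E3, E4, E5])
  obtain ⟨s, t, hst⟩ := hJ.apply_mem_of_not_central hz hw _ hK lie_mem_closedKernel hE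
  have hJE : J E ∈ closedKernel g := hst ▸ lie_mem_closedKernel s t
  obtain ⟨J1, J2, J3, J4⟩ := hD _ hJE
  obtain ⟨A, A1, A2, A3, A4, A5, A6⟩ := exists_coframe_apply_eq hg hf hv ![1, 0, 0, 0, 0, 0]
  simp at A1 A2 A3 A4 A5 A6
  -- If the bracket vanishes, `J E` is a multiple of `E`, which is impossible. Otherwise `F` is a
  -- bracket with `J E`, although τ kills every bracket with an element of [𝔤,𝔤] and τ(F) = 1.
  by_cases hA : ⁅A, J E⁆ = 0
  · have h5 : τ (J E) = 0 := by
      have h := hρ A (J E)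
      rw [hA, J1, J2, J3, J4, A1, A2, A3, A4, A5] at h
      simpa using h.symm
    have h6 : J E = ρ (J E) • E := by
      rw [← sub_eq_zero]
      refine hv _ (sub_mem hJE (Submodule.smul_mem _ _ hE)) ?_ ?_
      · simp [h5, E5]
      · simp [E6]
    have := hJ.eq_zero_of_apply_eq_smul h6
    rw [this] at E6
    simp at E6
  · obtain ⟨x, hx⟩ := hJ.exists_eq_lie hEc hA _ hK lie_mem_closedKernel hF
    rw [hx, hτ, J1, J2] at F5
    simp at F5

/-- A `3`-step algebra with a complex structure is `(0,0,0,0,12,14+25)`. -/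
theorem nonempty_lieEquiv_of_three_step (hg : finrank ℝ g = 6) (hb : firstBetti g = 4)
    {a b c d τ ρ : Dual ℝ g} (hf : IsClosedFrame a b c d) (hv : IsVerticalPair τ ρ)
    {k l m : ℝ} (hτ : ∀ x y, τ ⁅x, y⁆ = a x * b y - b x * a y)
    (hρ : ∀ x y, ρ ⁅x, y⁆ = (τ x * a y - a x * τ y) + k * (b x * c y - c x * b y) +
      l * (b x * d y - d x * b y) + m * (c x * d y - d x * c y))
    {J : g →ₗ[ℝ] g} (hJ : IsComplexStructure J) :
    Nonempty (g ≃ₗ⁅ℝ⁆ nla_12_14p25.Algebra) := by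
  have hcentral : ∀ x : g, (∀ y, τ ⁅y, x⁆ = 0) → (∀ y, ρ ⁅y, x⁆ = 0) → ∀ y : g, ⁅y, x⁆ = 0 :=
    fun x h1 h2 y => hv _ (lie_mem_closedKernel _ _) (h1 y) (h2 y)
  obtain ⟨A, A1, A2, A3, A4, A5, A6⟩ := exists_coframe_apply_eq hg hf hv ![1, 0, 0, 0, 0, 0]
  obtain ⟨B, B1, B2, B3, B4, B5, B6⟩ := exists_coframe_apply_eq hg hf hv ![0, 1, 0, 0, 0, 0]
  obtain ⟨C, C1, C2, C3, C4, C5, C6⟩ := exists_coframe_apply_eq hg hf hv ![0, 0, 1, 0, 0, 0]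
  obtain ⟨D, D1, D2, D3, D4, D5, D6⟩ := exists_coframe_apply_eq hg hf hv ![0, 0, 0, 1, 0, 0]
  simp at A1 A2 A3 A4 A5 A6 B1 B2 B3 B4 B5 B6 C1 C2 C3 C4 C5 C6 D1 D2 D3 D4 D5 D6
  have hab : ∀ x, (∀ y : g, ⁅y, x⁆ = 0) → a x = 0 ∧ b x = 0 ∧ τ x = 0 := by
    intro x hx
    have h1 := hτ A x
    have h2 := hτ B x
    have h3 := hρ A x
    rw [hx, map_zero, A1, A2] at h1
    rw [hx, map_zero, B1, B2] at h2
    rw [hx, map_zero, A1, A2, A3, A4, A5] at h3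
    exact ⟨by linarith, by linarith, by linarith⟩
  by_cases hm : m = 0
  · by_cases hkl : k = 0 ∧ l = 0
    · exfalso
      -- The centre is the kernel of this map, of odd dimension 3.
      let T : g →ₗ[ℝ] (Fin 3 → ℝ) := LinearMap.pi ![a, b, τ]
      have hT : Function.Surjective T := by
        intro r
        obtain ⟨x, h1, h2, h3, h4, h5, h6⟩ :=
          exists_coframe_apply_eq hg hf hv ![r 0, r 1, 0, 0, r 2, 0]
        refine ⟨x, ?_⟩
        funext i
        fin_cases i <;> assumption
      have hTmem : ∀ x, x ∈ LinearMap.ker T ↔ ∀ y : g, ⁅y, x⁆ = 0 := by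
        intro x
        constructor
        · intro hx
          have h : ∀ i, ![a, b, τ] i x = 0 := fun i => congrFun (LinearMap.mem_ker.1 hx) i
          have h1 : a x = 0 := h 0
          have h2 : b x = 0 := h 1
          have h3 : τ x = 0 := h 2
          exact hcentral x (fun y => by simp [hτ, h1, h2])
            (fun y => by simp [hρ, h1, h3, hm, hkl.1, hkl.2])
        · intro hx
          obtain ⟨h1, h2, h3⟩ := hab x hx
          refine LinearMap.mem_ker.2 ?_
          funext i
          fin_cases i <;> assumption
      have h1 := finrank_ker_of_surjective hg T hT
      have h2 := hJ.even_finrank (LinearMap.ker T) fun x hx => (hTmem _).2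
        (hJ.central_apply hg hb hf hv hτ hρ ((hTmem x).1 hx))
      obtain ⟨r, hr⟩ := h2
      omega
    · have hn : k ^ 2 + l ^ 2 ≠ 0 := by
        intro h
        exact hkl ⟨by nlinarith [sq_nonneg k, sq_nonneg l], by nlinarith [sq_nonneg k, sq_nonneg l]⟩
      -- Here dρ = a∧τ - b∧(kc + ld), so e¹ = b, e² = a and e⁴ = -(kc + ld); e³ is any complement,
      -- here the rotated form.
      refine nonempty_lieEquiv_of_closedFrame hg nla_12_14p25 rfl rfl rfl rfl
        (a := b) (b := a) (c := l • c - k • d) (d := -(k • c + l • d)) (p := τ) (q := ρ)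
        ⟨hf.mem₂, hf.mem₁, ?_, ?_, fun x h1 h2 h3 h4 => ?_⟩ (fun x hx h1 h2 => ?_) ?_ ?_
      · exact sub_mem (Submodule.smul_mem _ _ hf.mem₃) (Submodule.smul_mem _ _ hf.mem₄)
      · exact neg_mem (add_mem (Submodule.smul_mem _ _ hf.mem₃) (Submodule.smul_mem _ _ hf.mem₄))
      · simp at h3 h4
        have h5 : (k ^ 2 + l ^ 2) * c x = 0 := by linear_combination l * h3 - k * h4
        have h6 : (k ^ 2 + l ^ 2) * d x = 0 := by linear_combination -l * h4 - k * h3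
        exact hf.sep x h2 h1 ((mul_eq_zero.1 h5).resolve_left hn)
          ((mul_eq_zero.1 h6).resolve_left hn)
      · exact hv x hx h1 h2
      · intro x y
        simp [structBracket, nla_12_14p25, hτ]
      · intro x y
        simp [structBracket, nla_12_14p25, hρ, hm]
        ring
  · exfalso
    -- When m ≠ 0 the centre is only the line on which these five forms vanish, again of odd
    -- dimension.
    let T : g →ₗ[ℝ] (Fin 5 → ℝ) := LinearMap.pi ![a, b, c, d, τ]
    have hT : Function.Surjective T := by
      intro r
      obtain ⟨x, h1, h2, h3, h4, h5, h6⟩ :=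
        exists_coframe_apply_eq hg hf hv ![r 0, r 1, r 2, r 3, r 4, 0]
      refine ⟨x, ?_⟩
      funext i
      fin_cases i <;> assumption
    have hTmem : ∀ x, x ∈ LinearMap.ker T ↔ ∀ y : g, ⁅y, x⁆ = 0 := by
      intro x
      constructor
      · intro hx
        have h : ∀ i, ![a, b, c, d, τ] i x = 0 := fun i => congrFun (LinearMap.mem_ker.1 hx) i
        have h1 : a x = 0 := h 0
        have h2 : b x = 0 := h 1
        have h3 : c x = 0 := h 2
        have h4 : d x = 0 := h 3
        have h5 : τ x = 0 := h 4
        exact hcentral x (fun y => by simp [hτ, h1, h2])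
          (fun y => by simp [hρ, h1, h2, h3, h4, h5])
      · intro hx
        obtain ⟨h1, h2, h3⟩ := hab x hx
        have h4 := hρ C x
        have h5 := hρ D x
        rw [hx, map_zero, C1, C2, C3, C4, C5, h2] at h4
        rw [hx, map_zero, D1, D2, D3, D4, D5, h2] at h5
        have h6 : c x = 0 := by simpa [hm, h1] using h5
        have h7 : d x = 0 := by simpa [hm, h1] using h4
        refine LinearMap.mem_ker.2 ?_
        funext i
        fin_cases i <;> assumption
    have h1 := finrank_ker_of_surjective hg T hT
    have h2 := hJ.even_finrank (LinearMap.ker T) fun x hx => (hTmem _).2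
      (hJ.central_apply hg hb hf hv hτ hρ ((hTmem x).1 hx))
    obtain ⟨r, hr⟩ := h2
    omega

end ComplexStructure

/-! ### Structure equations of the 3-step algebras and the classification. -/

section ThreeStep

variable {g : Type*} [LieRing g] [LieAlgebra ℝ g]

/-- Normal form of the structure equations when `[g, [g, g]]` is a central line. -/
theorem exists_three_step_frame (hg : finrank ℝ g = 6) (hb : firstBetti g = 4) {z c₀ : g}
    (hz : z ∈ closedKernel g) (hc₀ : c₀ ∈ closedKernel g)
    (hli : LinearIndependent ℝ ![c₀, z]) (hcen : ∀ x : g, ⁅x, c₀⁆ = 0)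
    (hlie : ∀ x : g, ∃ r : ℝ, ⁅z, x⁆ = r • c₀) (hne : ∃ x : g, ⁅z, x⁆ ≠ 0) :
    ∃ (a b c d τ ρ : Dual ℝ g) (k l m : ℝ), IsClosedFrame a b c d ∧ IsVerticalPair τ ρ ∧
      (∀ x y, τ ⁅x, y⁆ = a x * b y - b x * a y) ∧
      ∀ x y, ρ ⁅x, y⁆ = (τ x * a y - a x * τ y) + k * (b x * c y - c x * b y) +
        l * (b x * d y - d x * b y) + m * (c x * d y - d x * c y) := by
  have : FiniteDimensional ℝ g := FiniteDimensional.of_finrank_pos (by omega)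
  have hcen' : ∀ x : g, ⁅c₀, x⁆ = 0 := fun x => by rw [← lie_skew, hcen, neg_zero]
  have hspan : ∀ x ∈ closedKernel g, ∃ s t : ℝ, x = s • c₀ + t • z := by
    intro x hx
    have hm : ∀ i, ![c₀, z] i ∈ closedKernel g := by
      intro i
      fin_cases i <;> assumption
    rw [← span_range_eq_of_finrank_eq _ hli hm (finrank_closedKernel hg hb).symm] at hx
    obtain ⟨k, rfl⟩ := (Submodule.mem_span_range_iff_exists_fun ℝ).1 hx
    exact ⟨k 0, k 1, by simp [Fin.sum_univ_two]⟩
  obtain ⟨τ, ρ, hτc, hτz, hρc, hρz⟩ :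
      ∃ τ ρ : Dual ℝ g, τ c₀ = 0 ∧ τ z = 1 ∧ ρ c₀ = 1 ∧ ρ z = 0 := by
    let B := Basis.span hli
    obtain ⟨τ, hτ⟩ := LinearMap.exists_extend (B.coord 1)
    obtain ⟨ρ, hρ⟩ := LinearMap.exists_extend (B.coord 0)
    have hB : ∀ i, ((B i : Submodule.span ℝ (Set.range ![c₀, z])) : g) = ![c₀, z] i := fun i => by
      simp [B, Basis.span_apply]
    have h1 : ∀ i, τ (![c₀, z] i) = B.coord 1 (B i) := fun i => by rw [← hτ, ← hB]; rfl
    have h2 : ∀ i, ρ (![c₀, z] i) = B.coord 0 (B i) := fun i => by rw [← hρ, ← hB]; rfl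
    refine ⟨τ, ρ, ?_, ?_, ?_, ?_⟩
    · simpa using h1 0
    · simpa using h1 1
    · simpa using h2 0
    · simpa using h2 1
  have hdec : ∀ x ∈ closedKernel g, x = ρ x • c₀ + τ x • z := by
    intro x hx
    obtain ⟨s, t, rfl⟩ := hspan x hx
    simp [hτc, hτz, hρc, hρz]
  have hDlie : ∀ x ∈ closedKernel g, ∀ y : g, ⁅x, y⁆ = τ x • ⁅z, y⁆ := by
    intro x hx y
    conv_lhs => rw [hdec x hx]
    simp [hcen']
  -- `α` is defined by [z,y] = α(y)c₀; it is closed because [𝔤,𝔤] is abelian.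
  let α : Dual ℝ g :=
    { toFun := fun y => ρ ⁅z, y⁆
      map_add' := by simp
      map_smul' := by simp }
  have hα : ∀ y, α y = ρ ⁅z, y⁆ := fun _ => rfl
  have hτzy : ∀ y, τ ⁅z, y⁆ = 0 := fun y => by
    obtain ⟨r, hr⟩ := hlie y
    simp [hr, hτc]
  have hαmem : α ∈ closedOneForms g := mem_closedOneForms.2 fun x y => by
    rw [hα, ← lie_skew, hDlie _ (lie_mem_closedKernel x y), lie_self]
    simp
  have hα0 : α ≠ 0 := by
    intro h
    obtain ⟨x, hx⟩ := hne
    refine hx ?_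
    obtain ⟨r, hr⟩ := hlie x
    have h1 : α x = r := by rw [hα, hr]; simp [hρc]
    rw [h] at h1
    rw [hr, ← h1]
    simp
  have hτclosed : τ ∉ closedOneForms g := fun h => by
    have := mem_closedKernel.1 hz τ h
    rw [hτz] at this
    exact one_ne_zero this
  obtain ⟨b, c, d, hf⟩ := exists_closedFrame_cons_one hg hb hα0 hαmem
  let ω : g →ₗ[ℝ] g →ₗ[ℝ] ℝ :=
    LinearMap.mk₂ ℝ (fun x y : g => τ ⁅x, y⁆) (by simp) (by simp) (by simp) (by simp)
  obtain ⟨k₁₂, k₁₃, k₁₄, k₂₃, k₂₄, k₃₄, hω⟩ := hf.exists_expansion hg hb ω (by simp [ω])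
    (fun x hx y => by simp [ω, hDlie x hx y, hτzy])
  replace hω : ∀ x y, τ ⁅x, y⁆ = _ := hω
  -- The ρ-component of the Jacobi identity says dτ∧α = 0, so `α` divides dτ: the coefficients not
  -- involving `α` vanish below.
  have hjac : ∀ x y w, τ ⁅x, y⁆ * α w + τ ⁅y, w⁆ * α x + τ ⁅w, x⁆ * α y = 0 := by
    have h1 : ∀ x y w, ρ ⁅⁅x, y⁆, w⁆ = τ ⁅x, y⁆ * α w := fun x y w => by
      rw [hDlie _ (lie_mem_closedKernel x y), map_smul, hα, smul_eq_mul]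
    intro x y w
    rw [← h1, ← h1, ← h1, ← map_add, ← map_add]
    have h2 := lie_jacobi x y w
    rw [← lie_skew x ⁅y, w⁆, ← lie_skew y ⁅w, x⁆, ← lie_skew w ⁅x, y⁆] at h2
    have h3 : ⁅⁅x, y⁆, w⁆ + ⁅⁅y, w⁆, x⁆ + ⁅⁅w, x⁆, y⁆ = 0 := by
      rw [← neg_eq_zero, ← h2]
      abel
    rw [h3, map_zero]
  obtain ⟨A, A1, A2, A3, A4⟩ := hf.exists_apply_eq hg hb 0 0 0 1
  obtain ⟨B, B1, B2, B3, B4⟩ := hf.exists_apply_eq hg hb 1 0 0 0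
  obtain ⟨C, C1, C2, C3, C4⟩ := hf.exists_apply_eq hg hb 0 1 0 0
  obtain ⟨D, D1, D2, D3, D4⟩ := hf.exists_apply_eq hg hb 0 0 1 0
  have e12 : k₁₂ = 0 := by
    simpa [hω, A1, A2, A3, A4, B1, B2, B3, B4, C1, C2, C3, C4] using
      hjac B C A
  have e13 : k₁₃ = 0 := by
    simpa [hω, A1, A2, A3, A4, B1, B2, B3, B4, D1, D2, D3, D4] using
      hjac B D A
  have e23 : k₂₃ = 0 := by
    simpa [hω, A1, A2, A3, A4, C1, C2, C3, C4, D1, D2, D3, D4] using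
      hjac C D A
  set β : Dual ℝ g := -(k₁₄ • b + k₂₄ • c + k₃₄ • d) with hβ
  have hβmem : β ∈ closedOneForms g := neg_mem (add_mem (add_mem
    (Submodule.smul_mem _ _ hf.mem₁) (Submodule.smul_mem _ _ hf.mem₂))
    (Submodule.smul_mem _ _ hf.mem₃))
  have hτ : ∀ x y, τ ⁅x, y⁆ = α x * β y - β x * α y := fun x y => by
    simp [hω, e12, e13, e23, hβ]
    ring
  have hi : LinearIndependent ℝ ![α, β] := by
    rw [LinearIndependent.pair_iff]
    intro s t hst
    have e : ∀ x, s * α x + t * β x = 0 := fun x => by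
      simpa using congrArg (fun f : Dual ℝ g => f x) hst
    have key : ∀ r : ℝ, (∀ x y, r * (α x * β y - β x * α y) = 0) → r = 0 := by
      intro r hr
      by_contra h
      refine hτclosed (mem_closedOneForms.2 fun x y => ?_)
      rw [hτ]
      exact (mul_eq_zero.1 (hr x y)).resolve_left h
    exact ⟨key s fun x y => by linear_combination β y * e x - β x * e y,
      key t fun x y => by linear_combination α x * e y - α y * e x⟩
  obtain ⟨γ, δ, hf'⟩ := exists_closedFrame_cons_two hg hb hi hαmem hβmem
  have hF : IsClosedFrame α β γ δ :=
    ⟨hf'.mem₃, hf'.mem₄, hf'.mem₁, hf'.mem₂, fun x h1 h2 h3 h4 => hf'.sep x h3 h4 h1 h2⟩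
  -- Subtracting τ∧α removes the dependence on [𝔤,𝔤], so the rest expands in the closed frame.
  let η : g →ₗ[ℝ] g →ₗ[ℝ] ℝ :=
    LinearMap.mk₂ ℝ (fun x y : g => ρ ⁅x, y⁆ - (τ x * α y - α x * τ y))
      (fun _ _ _ => by simp only [add_lie, map_add]; ring)
      (fun _ _ _ => by simp only [smul_lie, map_smul, smul_eq_mul]; ring)
      (fun _ _ _ => by simp only [lie_add, map_add]; ring)
      (fun _ _ _ => by simp only [lie_smul, map_smul, smul_eq_mul]; ring)
  obtain ⟨h₁₂, h₁₃, h₁₄, h₂₃, h₂₄, h₃₄, hη⟩ := hF.exists_expansion hg hb η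
    (fun x => by simp [η]; ring)
    (fun x hx y => by
      have h1 : α x = 0 := mem_closedKernel.1 hx α hαmem
      simp only [η, LinearMap.mk₂_apply, h1, hDlie x hx y, map_smul, ← hα y, smul_eq_mul]
      ring)
  replace hη : ∀ x y, ρ ⁅x, y⁆ - (τ x * α y - α x * τ y) = _ := hη
  -- The terms containing `α` are absorbed in τ by adding closed forms, which leaves dτ unchanged.
  refine ⟨α, β, γ, δ, τ - (h₁₂ • β + h₁₃ • γ + h₁₄ • δ), ρ, h₂₃, h₂₄, h₃₄, hF, ?_, ?_, ?_⟩
  · intro x hx h1 h2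
    have h3 : τ x = 0 := by
      simpa [mem_closedKernel.1 hx _ hF.mem₂, mem_closedKernel.1 hx _ hF.mem₃,
        mem_closedKernel.1 hx _ hF.mem₄] using h1
    rw [hdec x hx, h2, h3]
    simp
  · intro x y
    simp [hτ, mem_closedOneForms.1 hF.mem₂ x y, mem_closedOneForms.1 hF.mem₃ x y,
      mem_closedOneForms.1 hF.mem₄ x y]
  · intro x y
    simp
    linear_combination hη x y

/-- The closed 1-forms are the annihilator of [𝔤,𝔤], and the double annihilator gives the subspace
back. -/
theorem closedKernel_eq_lowerCentralSeries [FiniteDimensional ℝ g] :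
    closedKernel g = (LieModule.lowerCentralSeries ℝ g g 1).toSubmodule := by
  have h : closedOneForms g =
      (LieModule.lowerCentralSeries ℝ g g 1).toSubmodule.dualAnnihilator := by
    ext σ
    rw [mem_closedOneForms, Submodule.mem_dualAnnihilator]
    constructor
    · intro hσ w hw
      rw [LieModule.lowerCentralSeries_succ, LieModule.lowerCentralSeries_zero,
        LieSubmodule.lieIdeal_oper_eq_linear_span'] at hw
      induction hw using Submodule.span_induction with
      | mem x hx =>
        obtain ⟨a, -, b, -, rfl⟩ := hx
        exact hσ a b
      | zero => simp
      | add x y _ _ hx hy => simp [hx, hy]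
      | smul c x _ hx => simp [hx]
    · intro hσ x y
      refine hσ _ ?_
      rw [LieModule.lowerCentralSeries_succ]
      exact LieSubmodule.lie_mem_lie (LieSubmodule.mem_top x) (LieSubmodule.mem_top y)
  rw [closedKernel, h, Subspace.dualAnnihilator_dualCoannihilator_eq]

/-- In a nilpotent Lie algebra the lower central series strictly decreases until it vanishes. -/
theorem lowerCentralSeries_succ_lt [LieRing.IsNilpotent g] {k : ℕ}
    (h : LieModule.lowerCentralSeries ℝ g g k ≠ ⊥) :
    LieModule.lowerCentralSeries ℝ g g (k + 1) < LieModule.lowerCentralSeries ℝ g g k := by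
  refine lt_of_le_of_ne (LieModule.antitone_lowerCentralSeries ℝ g g k.le_succ) fun heq => h ?_
  obtain ⟨n, hn⟩ := LieModule.IsNilpotent.nilpotent ℝ g g
  have hconst : ∀ m, LieModule.lowerCentralSeries ℝ g g (k + m) =
      LieModule.lowerCentralSeries ℝ g g k := by
    intro m
    induction m with
    | zero => rfl
    | succ m ih =>
      rw [← add_assoc, LieModule.lowerCentralSeries_succ, ih, ← LieModule.lowerCentralSeries_succ,
        heq]
  rw [← hconst n, eq_bot_iff, ← hn]
  exact LieModule.antitone_lowerCentralSeries ℝ g g (Nat.le_add_left n k)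

theorem lie_mem_lowerCentralSeries_succ {k : ℕ} (x : g) {y : g}
    (hy : y ∈ LieModule.lowerCentralSeries ℝ g g k) :
    ⁅x, y⁆ ∈ LieModule.lowerCentralSeries ℝ g g (k + 1) := by
  rw [LieModule.lowerCentralSeries_succ]
  exact LieSubmodule.lie_mem_lie (LieSubmodule.mem_top x) hy

/-- A nilpotent algebra with `b₁ = 4` and a complex structure is one of the five algebras. -/
theorem classification_of_complex_structure [LieRing.IsNilpotent g] (hg : finrank ℝ g = 6)
    (hb : firstBetti g = 4) {J : g →ₗ[ℝ] g} (hJ : IsComplexStructure J) :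
    Nonempty (g ≃ₗ⁅ℝ⁆ nla_12_14p25.Algebra) ∨ IsTwoStepModel g := by
  have : FiniteDimensional ℝ g := FiniteDimensional.of_finrank_pos (by omega)
  have hK := finrank_closedKernel hg hb
  have hmem : ∀ x, x ∈ closedKernel g ↔ x ∈ LieModule.lowerCentralSeries ℝ g g 1 := fun x => by
    rw [closedKernel_eq_lowerCentralSeries]
    rfl
  by_cases h2 : LieModule.lowerCentralSeries ℝ g g 2 = ⊥
  · refine Or.inr (isTwoStepModel_of_closedKernel_central hg hb fun x hx y => ?_)
    have h := lie_mem_lowerCentralSeries_succ y ((hmem x).1 hx)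
    rw [h2, LieSubmodule.mem_bot] at h
    rw [← lie_skew, h, neg_zero]
  · have h1 : LieModule.lowerCentralSeries ℝ g g 1 ≠ ⊥ := fun h =>
      h2 (le_bot_iff.1 (h ▸ LieModule.antitone_lowerCentralSeries ℝ g g one_le_two))
    have l21 := lowerCentralSeries_succ_lt h1
    have l32 := lowerCentralSeries_succ_lt h2
    have f21 := Submodule.finrank_lt_finrank_of_lt (show (LieModule.lowerCentralSeries ℝ g g 2).toSubmodule <
      (LieModule.lowerCentralSeries ℝ g g 1).toSubmodule from l21)
    have f32 := Submodule.finrank_lt_finrank_of_lt (show (LieModule.lowerCentralSeries ℝ g g 3).toSubmodule <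
      (LieModule.lowerCentralSeries ℝ g g 2).toSubmodule from l32)
    rw [closedKernel_eq_lowerCentralSeries] at hK
    -- The dimensions decrease strictly from 2 through two steps, so they are 2, 1, 0.
    have f2 : finrank ℝ (LieModule.lowerCentralSeries ℝ g g 2).toSubmodule = 1 := by
      omega
    have h3 : LieModule.lowerCentralSeries ℝ g g 3 = ⊥ := by
      rw [← LieSubmodule.toSubmodule_eq_bot, ← Submodule.finrank_eq_zero]
      omega
    obtain ⟨z, hz1, hz2⟩ := SetLike.exists_of_lt l21
    obtain ⟨⟨c₀, hc2⟩, hc0, hspan⟩ := finrank_eq_one_iff'.1 f2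
    have hc0' : c₀ ≠ 0 := fun h => hc0 (Subtype.ext h)
    have hline : ∀ w ∈ LieModule.lowerCentralSeries ℝ g g 2, ∃ r : ℝ, w = r • c₀ := fun w hw => by
      obtain ⟨r, hr⟩ := hspan ⟨w, hw⟩
      exact ⟨r, (congrArg Subtype.val hr).symm⟩
    have hc1 : c₀ ∈ LieModule.lowerCentralSeries ℝ g g 1 := l21.le hc2
    have hcen : ∀ x : g, ⁅x, c₀⁆ = 0 := fun x => by
      have h := lie_mem_lowerCentralSeries_succ x hc2
      rwa [h3, LieSubmodule.mem_bot] at h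
    have hli : LinearIndependent ℝ ![c₀, z] := by
      rw [LinearIndependent.pair_iff' hc0']
      intro a ha
      exact hz2 (ha ▸ (LieModule.lowerCentralSeries ℝ g g 2).smul_mem a hc2)
    have hlie : ∀ x : g, ∃ r : ℝ, ⁅z, x⁆ = r • c₀ := fun x => by
      refine hline _ ?_
      rw [← lie_skew]
      exact neg_mem (lie_mem_lowerCentralSeries_succ x hz1)
    -- If `z` were central too, [𝔤,𝔤], spanned by c₀ and z, would be central and the next term zero.
    have hne : ∃ x : g, ⁅z, x⁆ ≠ 0 := by
      by_contra! hall
      refine h2 ?_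
      rw [← LieSubmodule.toSubmodule_eq_bot, LieModule.lowerCentralSeries_succ,
        LieSubmodule.lieIdeal_oper_eq_linear_span', Submodule.span_eq_bot]
      rintro _ ⟨x, -, y, hy, rfl⟩
      have hm : ∀ i, ![c₀, z] i ∈ (LieModule.lowerCentralSeries ℝ g g 1).toSubmodule := by
        intro i
        fin_cases i <;> assumption
      have hy' : y ∈ (LieModule.lowerCentralSeries ℝ g g 1).toSubmodule := hy
      rw [← span_range_eq_of_finrank_eq _ hli hm hK.symm] at hy'
      obtain ⟨k, rfl⟩ := (Submodule.mem_span_range_iff_exists_fun ℝ).1 hy'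
      have hxz : ⁅x, z⁆ = 0 := by rw [← lie_skew, hall, neg_zero]
      simp [Fin.sum_univ_two, hcen, hxz]
    obtain ⟨a, b, c, d, τ, ρ, k, l, m, hf, hv, hτ, hρ⟩ := exists_three_step_frame hg hb
      ((hmem z).2 hz1) ((hmem c₀).2 hc1) hli hcen hlie hne
    exact Or.inl (nonempty_lieEquiv_of_three_step hg hb hf hv hτ hρ hJ)

end ThreeStep

/-! ### Invariance of V₁ in the last four algebras. -/

section Invariance

variable {g : Type*} [LieRing g] [LieAlgebra ℝ g]

/-- The coordinates of an isomorphism with an algebra given by structure equations. -/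
def StructureEquations.coords {n : ℕ} {S : StructureEquations n} (φ : g ≃ₗ⁅ℝ⁆ S.Algebra) :
    g ≃ₗ[ℝ] (Fin n → ℝ) :=
  φ.toLinearEquiv

theorem StructureEquations.coords_lie {n : ℕ} {S : StructureEquations n}
    (φ : g ≃ₗ⁅ℝ⁆ S.Algebra) (x y : g) :
    coords φ ⁅x, y⁆ = structBracket S.form (coords φ x) (coords φ y) :=
  φ.toLieHom.map_lie x y

open StructureEquations

theorem finrank_eq_of_lieEquiv {S : StructureEquations 6} (φ : g ≃ₗ⁅ℝ⁆ S.Algebra) :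
    finrank ℝ g = 6 := by
  simpa using (coords φ).finrank_eq

/-- If the first four coordinate forms are closed, every complex structure that does not preserve
the centre preserves `V₁`. -/
theorem dualMap_mem_closedOneForms_of_not_central {S : StructureEquations 6}
    (φ : g ≃ₗ⁅ℝ⁆ S.Algebra) (h0 : S.form 0 = []) (h1 : S.form 1 = []) (h2 : S.form 2 = [])
    (h3 : S.form 3 = []) {J : g →ₗ[ℝ] g} (hJ : IsComplexStructure J) {σ : Dual ℝ g}
    (hσ : σ ∈ closedOneForms g) {z w : g} (hz : ∀ x : g, ⁅x, z⁆ = 0) (hw : ⁅w, J z⁆ ≠ 0) :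
    J.dualMap σ ∈ closedOneForms g := by
  have hg := finrank_eq_of_lieEquiv φ
  have hn : 4 ≤ 6 := by norm_num
  -- The kernel of the first four coordinates is a plane containing all brackets, which is all that
  -- is needed here.
  let T : g →ₗ[ℝ] (Fin 4 → ℝ) :=
    LinearMap.funLeft ℝ ℝ (Fin.castLE hn) ∘ₗ (coords φ).toLinearMap
  have hT : Function.Surjective T :=
    (LinearMap.funLeft_surjective_of_injective ℝ ℝ (Fin.castLE hn)
      (Fin.castLE_injective hn)).comp (coords φ).surjective
  have hK : finrank ℝ (LinearMap.ker T) = 2 := by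
    have := finrank_ker_of_surjective hg T hT
    omega
  have hlie : ∀ x y : g, ⁅x, y⁆ ∈ LinearMap.ker T := by
    intro x y
    rw [LinearMap.mem_ker]
    funext i
    change coords φ ⁅x, y⁆ (Fin.castLE _ i) = 0
    rw [coords_lie]
    fin_cases i <;> simp [structBracket, h0, h1, h2, h3]
  refine mem_closedOneForms.2 fun x y => ?_
  obtain ⟨s, t, hst⟩ := hJ.apply_mem_of_not_central hz hw _ hK hlie (hlie x y)
  rw [LinearMap.dualMap_apply, hst]
  exact mem_closedOneForms.1 hσ s t

/-- If the centre consists of brackets and contains all of them, then `V₁` is invariant. -/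
theorem dualMap_mem_closedOneForms_of_center {S : StructureEquations 6}
    (φ : g ≃ₗ⁅ℝ⁆ S.Algebra) (h0 : S.form 0 = []) (h1 : S.form 1 = []) (h2 : S.form 2 = [])
    (h3 : S.form 3 = []) (hlie : ∀ x y z : g, ⁅z, ⁅x, y⁆⁆ = 0)
    (hcen : ∀ z : g, (∀ x : g, ⁅x, z⁆ = 0) → ∃ x y : g, z = ⁅x, y⁆)
    {J : g →ₗ[ℝ] g} (hJ : IsComplexStructure J) {σ : Dual ℝ g}
    (hσ : σ ∈ closedOneForms g) : J.dualMap σ ∈ closedOneForms g := by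
  -- If J preserves the centre, J[x,y] is central, hence a bracket, hence killed by σ; otherwise J
  -- preserves the plane of brackets.
  by_cases h : ∀ z : g, (∀ x : g, ⁅x, z⁆ = 0) → ∀ w : g, ⁅w, J z⁆ = 0
  · refine mem_closedOneForms.2 fun x y => ?_
    obtain ⟨s, t, hst⟩ := hcen _ (h _ (hlie x y))
    rw [LinearMap.dualMap_apply, hst]
    exact mem_closedOneForms.1 hσ s t
  · push Not at h
    obtain ⟨z, hz, w, hw⟩ := h
    exact dualMap_mem_closedOneForms_of_not_central φ h0 h1 h2 h3 hJ hσ hz hw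

theorem lie_lie_eq_zero_of_two_step {S : StructureEquations 6} (φ : g ≃ₗ⁅ℝ⁆ S.Algebra)
    (hS : ∀ u v w, structBracket S.form w (structBracket S.form u v) = 0) (x y z : g) :
    ⁅z, ⁅x, y⁆⁆ = 0 := by
  apply (coords φ).injective
  rw [coords_lie, coords_lie, hS, map_zero]

theorem exists_eq_lie_of_structBracket {S : StructureEquations 6} (φ : g ≃ₗ⁅ℝ⁆ S.Algebra)
    (hS : ∀ w, (∀ v, structBracket S.form v w = 0) → ∃ u v, w = structBracket S.form u v)
    (z : g) (hz : ∀ x : g, ⁅x, z⁆ = 0) : ∃ x y : g, z = ⁅x, y⁆ := by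
  obtain ⟨u, v, huv⟩ := hS (coords φ z) fun v => by
    have h := coords_lie φ ((coords φ).symm v) z
    rw [hz, map_zero, LinearEquiv.apply_symm_apply] at h
    exact h.symm
  refine ⟨(coords φ).symm u, (coords φ).symm v, (coords φ).injective ?_⟩
  rw [coords_lie, LinearEquiv.apply_symm_apply, LinearEquiv.apply_symm_apply, huv]

theorem dualMap_mem_closedOneForms_12_34 (φ : g ≃ₗ⁅ℝ⁆ nla_12_34.Algebra)
    {J : g →ₗ[ℝ] g} (hJ : IsComplexStructure J) {σ : Dual ℝ g}
    (hσ : σ ∈ closedOneForms g) : J.dualMap σ ∈ closedOneForms g := by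
  refine dualMap_mem_closedOneForms_of_center φ rfl rfl rfl rfl
    (lie_lie_eq_zero_of_two_step φ fun u v w => ?_)
    (exists_eq_lie_of_structBracket φ fun w hw => ?_) hJ hσ
  · funext i
    fin_cases i <;> simp [structBracket, nla_12_34]
  -- Bracketing with basis vectors shows that the first four coordinates of a central vector vanish.
  · have a0 := congrFun (hw ![0, 1, 0, 0, 0, 0]) 4
    have a1 := congrFun (hw ![1, 0, 0, 0, 0, 0]) 4
    have a2 := congrFun (hw ![0, 0, 0, 1, 0, 0]) 5
    have a3 := congrFun (hw ![0, 0, 1, 0, 0, 0]) 5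
    simp [structBracket, nla_12_34] at a0 a1 a2 a3
    refine ⟨![-w 4, 0, -w 5, 0, 0, 0], ![0, 1, 0, 1, 0, 0], ?_⟩
    funext i
    fin_cases i <;> simp [structBracket, nla_12_34, a0, a1, a2, a3]

theorem dualMap_mem_closedOneForms_12_14p23 (φ : g ≃ₗ⁅ℝ⁆ nla_12_14p23.Algebra)
    {J : g →ₗ[ℝ] g} (hJ : IsComplexStructure J) {σ : Dual ℝ g}
    (hσ : σ ∈ closedOneForms g) : J.dualMap σ ∈ closedOneForms g := by
  refine dualMap_mem_closedOneForms_of_center φ rfl rfl rfl rfl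
    (lie_lie_eq_zero_of_two_step φ fun u v w => ?_)
    (exists_eq_lie_of_structBracket φ fun w hw => ?_) hJ hσ
  · funext i
    fin_cases i <;> simp [structBracket, nla_12_14p23]
  · have a0 := congrFun (hw ![0, 1, 0, 0, 0, 0]) 4
    have a1 := congrFun (hw ![1, 0, 0, 0, 0, 0]) 4
    have a2 := congrFun (hw ![0, 1, 0, 0, 0, 0]) 5
    have a3 := congrFun (hw ![1, 0, 0, 0, 0, 0]) 5
    simp [structBracket, nla_12_14p23] at a0 a1 a2 a3
    -- The first basis vector alone already has ad with image the whole centre.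
    refine ⟨![1, 0, 0, 0, 0, 0], ![0, -w 4, 0, -w 5, 0, 0], ?_⟩
    funext i
    fin_cases i <;> simp [structBracket, nla_12_14p23, a0, a1, a2, a3]

theorem dualMap_mem_closedOneForms_13p42_14p23 (φ : g ≃ₗ⁅ℝ⁆ nla_13p42_14p23.Algebra)
    {J : g →ₗ[ℝ] g} (hJ : IsComplexStructure J) {σ : Dual ℝ g}
    (hσ : σ ∈ closedOneForms g) : J.dualMap σ ∈ closedOneForms g := by
  refine dualMap_mem_closedOneForms_of_center φ rfl rfl rfl rfl
    (lie_lie_eq_zero_of_two_step φ fun u v w => ?_)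
    (exists_eq_lie_of_structBracket φ fun w hw => ?_) hJ hσ
  · funext i
    fin_cases i <;> simp [structBracket, nla_13p42_14p23]
  · have a0 := congrFun (hw ![0, 0, 1, 0, 0, 0]) 4
    have a1 := congrFun (hw ![0, 0, 0, 1, 0, 0]) 4
    have a2 := congrFun (hw ![1, 0, 0, 0, 0, 0]) 4
    have a3 := congrFun (hw ![1, 0, 0, 0, 0, 0]) 5
    simp [structBracket, nla_13p42_14p23] at a0 a1 a2 a3
    refine ⟨![1, 0, 0, 0, 0, 0], ![0, 0, -w 4, -w 5, 0, 0], ?_⟩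
    funext i
    fin_cases i <;> simp [structBracket, nla_13p42_14p23, a0, a1, a2, a3]

theorem structBracket_12_13_eq_zero (v : Fin 6 → ℝ) {w : Fin 6 → ℝ} (h0 : w 0 = 0)
    (h1 : w 1 = 0) (h2 : w 2 = 0) : structBracket nla_12_13.form v w = 0 := by
  funext i
  fin_cases i <;> simp [structBracket, nla_12_13, h0, h1, h2]

/-- Here the centre is larger than [𝔤,𝔤]: it is the common kernel of the first three coordinates, of
dimension 3. By parity J cannot preserve it, so J preserves [𝔤,𝔤] instead. -/
theorem dualMap_mem_closedOneForms_12_13 (φ : g ≃ₗ⁅ℝ⁆ nla_12_13.Algebra)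
    {J : g →ₗ[ℝ] g} (hJ : IsComplexStructure J) {σ : Dual ℝ g}
    (hσ : σ ∈ closedOneForms g) : J.dualMap σ ∈ closedOneForms g := by
  by_cases h : ∀ z : g, (∀ x : g, ⁅x, z⁆ = 0) → ∀ w : g, ⁅w, J z⁆ = 0
  · exfalso
    have hn : 3 ≤ 6 := by norm_num
    let T : g →ₗ[ℝ] (Fin 3 → ℝ) :=
      LinearMap.funLeft ℝ ℝ (Fin.castLE hn) ∘ₗ (coords φ).toLinearMap
    have hT : Function.Surjective T :=
      (LinearMap.funLeft_surjective_of_injective ℝ ℝ (Fin.castLE hn)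
        (Fin.castLE_injective hn)).comp (coords φ).surjective
    have hTmem : ∀ x, x ∈ LinearMap.ker T ↔ ∀ y : g, ⁅y, x⁆ = 0 := by
      intro x
      constructor
      · intro hx y
        have h0 : coords φ x 0 = 0 := congrFun (LinearMap.mem_ker.1 hx) 0
        have h1 : coords φ x 1 = 0 := congrFun (LinearMap.mem_ker.1 hx) 1
        have h2 : coords φ x 2 = 0 := congrFun (LinearMap.mem_ker.1 hx) 2
        apply (coords φ).injective
        rw [coords_lie, map_zero]
        exact structBracket_12_13_eq_zero _ h0 h1 h2
      · intro hx
        have hc : ∀ v i, structBracket nla_12_13.form v (coords φ x) i = 0 := fun v i => by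
          have h := coords_lie φ ((coords φ).symm v) x
          rw [hx, map_zero, LinearEquiv.apply_symm_apply] at h
          exact (congrFun h i).symm
        have a0 := hc ![0, 1, 0, 0, 0, 0] 4
        have a1 := hc ![1, 0, 0, 0, 0, 0] 4
        have a2 := hc ![1, 0, 0, 0, 0, 0] 5
        simp [structBracket, nla_12_13] at a0 a1 a2
        refine LinearMap.mem_ker.2 ?_
        funext i
        fin_cases i <;> assumption
    have h1 := finrank_ker_of_surjective (finrank_eq_of_lieEquiv φ) T hT
    obtain ⟨r, hr⟩ := hJ.even_finrank (LinearMap.ker T) fun x hx =>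
      (hTmem _).2 (h x ((hTmem x).1 hx))
    omega
  · push Not at h
    obtain ⟨z, hz, w, hw⟩ := h
    exact dualMap_mem_closedOneForms_of_not_central φ rfl rfl rfl rfl hJ hσ hz hw

end Invariance

theorem theorem3p3 (g : Type*) [LieRing g] [LieAlgebra ℝ g] :
    (LieRing.IsNilpotent g → Module.finrank ℝ g = 6 → firstBetti g = 4 →
      (∃ J : g →ₗ[ℝ] g, IsComplexStructure J) →
        Nonempty (g ≃ₗ⁅ℝ⁆ nla_12_14p25.Algebra) ∨
        Nonempty (g ≃ₗ⁅ℝ⁆ nla_12_13.Algebra) ∨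
        Nonempty (g ≃ₗ⁅ℝ⁆ nla_13p42_14p23.Algebra) ∨
        Nonempty (g ≃ₗ⁅ℝ⁆ nla_12_14p23.Algebra) ∨
        Nonempty (g ≃ₗ⁅ℝ⁆ nla_12_34.Algebra)) ∧
    ((Nonempty (g ≃ₗ⁅ℝ⁆ nla_12_13.Algebra) ∨
        Nonempty (g ≃ₗ⁅ℝ⁆ nla_13p42_14p23.Algebra) ∨
        Nonempty (g ≃ₗ⁅ℝ⁆ nla_12_14p23.Algebra) ∨
        Nonempty (g ≃ₗ⁅ℝ⁆ nla_12_34.Algebra)) →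
      ∀ J : g →ₗ[ℝ] g, IsComplexStructure J →
        ∀ σ ∈ closedOneForms g, J.dualMap σ ∈ closedOneForms g) := by
  refine ⟨fun hn hg hb ⟨J, hJ⟩ => ?_, ?_⟩
  · exact classification_of_complex_structure hg hb hJ
  · rintro (⟨⟨φ⟩⟩ | ⟨⟨φ⟩⟩ | ⟨⟨φ⟩⟩ | ⟨⟨φ⟩⟩) J hJ σ hσ
    · exact dualMap_mem_closedOneForms_12_13 φ hJ hσ
    · exact dualMap_mem_closedOneForms_13p42_14p23 φ hJ hσ
    · exact dualMap_mem_closedOneForms_12_14p23 φ hJ hσ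
    · exact dualMap_mem_closedOneForms_12_34 φ hJ hσ
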